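/- A permutation $\pi=\pi_1\cdots\pi_n$ of $\{1,\dots,n\}$ $(n\ge 0)$ is *alternating* if $\pi_i<\pi_{i+1}$ for every odd $i<n$ and $\pi_i>\pi_{i+1}$ for every even $i<n$ (so for $n=0,1$ the unique permutation is alternating). An alternating permutation of length $n\ge 2$ is *up-up* if it ends with a rise ($\pi_{n-1}<\pi_n$) and *up-down* if it ends with a descent ($\pi_{n-1}>\pi_n$). An occurrence of the pattern $1\text{-}3\text{-}2$ in $\pi$ is a triple $i<j<k$ with $\pi_i<\pi_k<\pi_j$. For $r\ge 0$ let $UD(x;r)$, $UU(x;r)$ and $A(x;r)$ be the ordinary generating functions, with $x$ marking the length $n\ge 0$, for the numbers of up-down, up-up and all alternating permutations, respectively, that contain $1\text{-}3\text{-}2$ exactly $r$ times. Then the following identities hold in the field $\mathbb{Q}((x))$ of formal Laurent series, where $(1-4x^2)^{e}=\sum_{k\ge0}\binom{e}{k}(-4x^2)^k$. (1) Up-down permutations: $$UD(x;0)=\frac{1-2x^2}{2x}-\frac{1}{2x}(1-4x^2)^{1/2},$$ $$UD(x;1)=\frac{-1}{2x}+\frac{1-2x^2}{2x}(1-4x^2)^{-1/2},$$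 $$UD(x;2)=\frac{1}{2x}-\frac{1-6x^2+6x^4}{2x}(1-4x^2)^{-3/2},$$ $$UD(x;3)=\frac{-2(1-x^2)}{x}+\frac{2-22x^2+80x^4-98x^6+16x^8}{x}(1-4x^2)^{-5/2}.$$ (2) Up-up permutations: $$UU(x;0)=\frac{1-2x^2}{2x^2}-\frac{1}{2x^2}(1-4x^2)^{1/2},$$ $$UU(x;1)=\frac{x^2-1}{x^2}+\frac{1-3x^2}{x^2}(1-4x^2)^{-1/2},$$ $$UU(x;2)=\frac{4-5x^2}{2x^2}-\frac{4-29x^2+54x^4-16x^6}{2x^2}(1-4x^2)^{-3/2},$$ $$UU(x;3)=-\frac{13-22x^2+2x^4}{2x^2}+\frac{13-152x^2+612x^4-940x^6+384x^8}{2x^2}(1-4x^2)^{-5/2}.$$ (3) All alternating permutations: $$A(x;0)=1+x+\frac{1+x-2x^2-2x^3}{2x^2}-\frac{1+x}{2x^2}(1-4x^2)^{1/2},$$ $$A(x;1)=\frac{2x^2-x-2}{2x^2}+\frac{2+x-6x^2-2x^3}{2x^2}(1-4x^2)^{-1/2},$$ $$A(x;2)=\frac{4+x-5x^2}{2x^2}-\frac{4+x-29x^2-6x^3+54x^4+6x^5-16x^6}{2x^2}(1-4x^2)^{-3/2},$$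 $$A(x;3)=-\frac{13+4x-22x^2-4x^3+2x^4}{2x^2}+\frac{13+4x-152x^2-44x^3+612x^4+160x^5-940x^6-196x^7+384x^8+32x^9}{2x^2}(1-4x^2)^{-5/2}.$$ -/

import Mathlib

open scoped PowerSeries LaurentSeries

namespace AltPerm

/-- The number of occurrences of the classical pattern `τ` in the permutation `π`: the number of
increasing sequences of positions `f 0 < ⋯ < f (k - 1)` such that `π (f 0), …, π (f (k - 1))` is
order-isomorphic to `τ`. Positions and letters are numbered from `0`. -/
def occ {k n : ℕ} (τ : Equiv.Perm (Fin k)) (π : Equiv.Perm (Fin n)) : ℕ :=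
  (Finset.univ.filter fun f : Fin k → Fin n =>
    (∀ a b, a < b → f a < f b) ∧ ∀ a b, π (f a) < π (f b) ↔ τ a < τ b).card

/-- The pattern 1-3-2, that is `0 ↦ 0`, `1 ↦ 2`, `2 ↦ 1`. -/
def pat132 : Equiv.Perm (Fin 3) := Equiv.swap 1 2

/-- `π` starts with a rise, and then descents and rises come in turn. -/
def IsAlternating {n : ℕ} (π : Equiv.Perm (Fin n)) : Prop :=
  ∀ (i : ℕ) (h : i + 1 < n),
    (Even i → π ⟨i, by lia⟩ < π ⟨i + 1, h⟩) ∧ (Odd i → π ⟨i + 1, h⟩ < π ⟨i, by lia⟩)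

/-- Up-up permutations: alternating, of length at least two, ending with a rise. -/
def IsUpUp {n : ℕ} (π : Equiv.Perm (Fin n)) : Prop :=
  IsAlternating π ∧ ∃ h : 2 ≤ n, π ⟨n - 2, by lia⟩ < π ⟨n - 1, by lia⟩

/-- Up-down permutations: alternating, of length at least two, ending with a descent. -/
def IsUpDown {n : ℕ} (π : Equiv.Perm (Fin n)) : Prop :=
  IsAlternating π ∧ ∃ h : 2 ≤ n, π ⟨n - 1, by lia⟩ < π ⟨n - 2, by lia⟩

open Classical in
/-- Ordinary generating function, by length, of the up-down permutations
with exactly `r` occurrences of 1-3-2. -/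
noncomputable def UD (r : ℕ) : ℚ⟦X⟧ := PowerSeries.mk fun n =>
  ((Finset.univ.filter fun π : Equiv.Perm (Fin n) => IsUpDown π ∧ occ pat132 π = r).card : ℚ)

open Classical in
/-- Ordinary generating function, by length, of the up-up permutations
with exactly `r` occurrences of 1-3-2. -/
noncomputable def UU (r : ℕ) : ℚ⟦X⟧ := PowerSeries.mk fun n =>
  ((Finset.univ.filter fun π : Equiv.Perm (Fin n) => IsUpUp π ∧ occ pat132 π = r).card : ℚ)

open Classical in
/-- Ordinary generating function, by length `n ≥ 0`, of all alternating permutations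
with exactly `r` occurrences of 1-3-2. -/
noncomputable def A (r : ℕ) : ℚ⟦X⟧ := PowerSeries.mk fun n =>
  ((Finset.univ.filter fun π : Equiv.Perm (Fin n) => IsAlternating π ∧ occ pat132 π = r).card : ℚ)

/-- The variable `x` as an element of the field of Laurent series. -/
noncomputable def x : ℚ⸨X⸩ := ((PowerSeries.X : ℚ⟦X⟧) : ℚ⸨X⸩)

/-- `(1 - 4 x ^ 2) ^ e` for a rational exponent `e`: the binomial series
`∑ k, (e choose k) t ^ k` at `t = -4 x ^ 2`, as a Laurent series. -/
noncomputable def S (e : ℚ) : ℚ⸨X⸩ :=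
  (((PowerSeries.binomialSeries ℚ e).subst (-4 * PowerSeries.X ^ 2 : ℚ⟦X⟧) : ℚ⟦X⟧) : ℚ⸨X⸩)

end AltPerm

/-! ### Words: alternation and occurrences of 1-3-2 under concatenation and relabelling. -/

namespace AltPerm

/-! Weight a word by `q ^ occL` in a ring where `q ^ 4 = 0`. Words with four or more occurrences
then vanish, and the coefficients of `1, q, q ^ 2, q ^ 3` are the counts for `r = 0, 1, 2, 3`.

Cut an alternating word at its largest letter: `σ N τ`, with `σ` of odd length and `σ`, `τ`
alternating (`sum_altWords_insert_max`). A letter `a` of `σ` below a letter `b` of `τ` gives an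
occurrence `a N b`, so few occurrences force `σ` to lie almost entirely above `τ`. With at most
three, only three shapes remain (`split_cases`): `σ` lies above `τ`; or only the last letter of `σ`,
its minimum, lies below some letters of `τ`; or `σ` ends with `v y m`, exactly one letter `M` of `τ`
exceeds `m`, and `v < M`, in which case the cut alone costs three occurrences. In each shape the set
of letters before `N` is explicit (`exists_eq_of_splitWt_ne_zero`), and `sum_splitWt` adds up the
weights.

Let `U`, `O` be the generating functions for even and odd lengths, and `T` either of them, with
initial coefficients `c₀`, `c₁`. The cut gives `T = c₀ + c₁ x + x (O T + x U · tail(T) + q ^ 3 (G +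
x ^ 3 U) (T - c₀))` (`altGF_eq`). Here `tail(T)` is linear in `T` up to initial terms, and `G` comes
from the third shape with `y > M`. Since `G` carries the factor `q ^ 3`, only its value without
occurrences matters, and there `G = x ^ 3 U ^ 2`.

Comparing powers of `q` yields a triangular system over `ℚ` (`altSeries_equations`): a quadratic
equation for the odd series with `r = 0`, then linear ones. With `c = x O₀` one has `x ^ 2 = c (1 -
c)` and `1 - 2 c = (1 - 4 x ^ 2) ^ (1 / 2)`, so every solution is rational in `c` (`solve_system`).
Up-down and up-up permutations are the alternating ones of odd and even length, apart from lengths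
`1` and `0`. -/

/-- The number of descents `b … c` (not necessarily adjacent) in `l` whose lower letter
exceeds `a`. -/
def invAbove (a : ℕ) : List ℕ → ℕ
  | [] => 0
  | b :: l => l.countP (fun c => a < c ∧ c < b) + invAbove a l

/-- The number of occurrences of 1-3-2 in a word. -/
def occL : List ℕ → ℕ
  | [] => 0
  | a :: l => invAbove a l + occL l

/-- Words that start with a rise, and then descents and rises come in turn. -/
def Alt : List ℕ → Prop
  | [] => True
  | [_] => True
  | a :: b :: l => a < b ∧ (∀ c ∈ l.head?, c < b) ∧ Alt l

theorem alt_iff_getElem : ∀ l : List ℕ, Alt l ↔ ∀ (i : ℕ) (h : i + 1 < l.length),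
    (Even i → l[i] < l[i + 1]) ∧ (Odd i → l[i + 1] < l[i])
  | [] => by simp [Alt]
  | [a] => by simp [Alt]
  | a :: b :: l => by
    rw [Alt, alt_iff_getElem l]
    constructor
    · rintro ⟨h1, h2, h3⟩ i hi
      match i with
      | 0 => simpa using h1
      | 1 =>
        match l with
        | [] => simp at hi
        | c :: l => simpa using h2
      | i + 2 =>
        have := h3 i (by simp at hi; omega)
        simpa [Nat.even_add, Nat.odd_add, parity_simps] using this
    · intro h
      refine ⟨by simpa using h 0 (by simp), ?_, fun i hi => ?_⟩
      · match l with
        | [] => simp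
        | c :: l => simpa using show c < b from (h 1 (by simp)).2 (by decide)
      · have := h (i + 2) (by simp; omega)
        exact ⟨fun e => this.1 (by simpa [parity_simps] using e),
          fun e => this.2 (by simpa [parity_simps] using e)⟩

/-- An even cut falls just before a valley, so the pattern of rises and descents starts afresh
there. -/
theorem alt_append_of_even : ∀ {s : List ℕ} (t : List ℕ), Even s.length →
    (Alt (s ++ t) → Alt s ∧ Alt t)
  | [], _, _ => by simp [Alt]
  | [_], _, h => by simp at h
  | a :: b :: s, t, h => by
    have h' : Even s.length := by simpa [parity_simps] using h
    intro H
    simp only [List.cons_append, Alt] at H ⊢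
    obtain ⟨h1, h2, h3⟩ := H
    have := alt_append_of_even t h' h3
    refine ⟨⟨h1, ?_, this.1⟩, this.2⟩
    match s with
    | [] => simp
    | c :: s => simpa using h2

theorem Alt.append {s t : List ℕ} (hs : Alt s) (ht : Alt t) (he : Even s.length)
    (hst : ∀ a ∈ s, ∀ b ∈ t.head?, b < a) : Alt (s ++ t) := by
  match s with
  | [] => simpa using ht
  | [_] => simp at he
  | a :: b :: s =>
    have h' : Even s.length := by simpa [parity_simps] using he
    simp only [List.cons_append, Alt] at hs ⊢
    refine ⟨hs.1, ?_, Alt.append hs.2.2 ht h' fun a ha => hst a (by simp [ha])⟩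
    match s with
    | [] => simpa using hst b (by simp)
    | c :: s => simpa using hs.2.1
termination_by s.length

/-- The word with a maximal letter `N` in it. -/
theorem alt_append_max {s τ : List ℕ} {z N : ℕ} (he : Even s.length)
    (hz : z < N) (hτ : ∀ b ∈ τ, b < N) :
    Alt (s ++ z :: N :: τ) ↔ Alt (s ++ [z]) ∧ Alt τ := by
  match s with
  | [] =>
    simp only [List.nil_append, Alt, true_and, hz]
    exact and_iff_right fun c hc => hτ c (List.mem_of_mem_head? hc)
  | [_] => simp at he
  | a :: b :: s =>
    have h' : Even s.length := by simpa [parity_simps] using he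
    simp only [List.cons_append, Alt]
    rw [alt_append_max h' hz hτ]
    have : (s ++ z :: N :: τ).head? = (s ++ [z]).head? := by cases s <;> simp
    rw [this]; tauto
termination_by s.length

theorem exists_append_singleton {α : Type*} {l : List α} (h : l ≠ []) :
    ∃ s z, l = s ++ [z] :=
  ⟨_, _, (List.dropLast_append_getLast h).symm⟩

theorem invAbove_le_of_sublist {a : ℕ} {l l' : List ℕ} (h : l.Sublist l') :
    invAbove a l ≤ invAbove a l' := by
  induction h with
  | slnil => rfl
  | cons b _ ih => simp only [invAbove]; omega
  | cons_cons b h ih =>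
    simp only [invAbove]
    have := h.countP_le (p := fun c => a < c ∧ c < b)
    omega

theorem occL_le_of_sublist {l l' : List ℕ} (h : l.Sublist l') : occL l ≤ occL l' := by
  induction h with
  | slnil => rfl
  | cons b _ ih => simp only [occL]; omega
  | cons_cons b h ih =>
    simp only [occL]
    have := invAbove_le_of_sublist (a := b) h
    omega

theorem invAbove_append (a : ℕ) (σ τ : List ℕ) : invAbove a (σ ++ τ) =
    invAbove a σ + (σ.map fun b => τ.countP fun c => a < c ∧ c < b).sum + invAbove a τ := by
  induction σ with
  | nil => simp [invAbove]
  | cons b σ ih => simp only [List.cons_append, invAbove, ih, List.countP_append, List.map_cons,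
      List.sum_cons]; omega

theorem invAbove_eq_zero {a : ℕ} {l : List ℕ} (h : ∀ c ∈ l, c ≤ a) : invAbove a l = 0 := by
  induction l with
  | nil => rfl
  | cons b l ih =>
    rw [invAbove, ih fun c hc => h c (by simp [hc]), add_zero, List.countP_eq_zero]
    intro c hc
    have := h c (by simp [hc])
    simp only [decide_eq_true_eq]; omega

theorem invAbove_cons_eq_zero {a b : ℕ} {l : List ℕ} (h : ∀ c ∈ l, c ≤ a) :
    invAbove a (b :: l) = 0 := by
  rw [invAbove, invAbove_eq_zero h, add_zero, List.countP_eq_zero]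
  intro c hc
  have := h c hc
  simp only [decide_eq_true_eq]; omega

/-- The number of occurrences of 1-3-2 in `σ ++ ρ` with letters from both `σ` and `ρ`. -/
def cross : List ℕ → List ℕ → ℕ
  | [], _ => 0
  | a :: σ, ρ => (σ.map fun b => ρ.countP fun c => a < c ∧ c < b).sum + invAbove a ρ + cross σ ρ

theorem occL_append (σ ρ : List ℕ) : occL (σ ++ ρ) = occL σ + cross σ ρ + occL ρ := by
  induction σ with
  | nil => simp [occL, cross]
  | cons a σ ih => rw [List.cons_append, occL, occL, ih, invAbove_append, cross]; omega

/-- Discards the mixed occurrences whose first letter lies in `s`: their middle letter is in `s ++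
w`, excluded by `h1`, or in `ρ`, excluded by `h2`. It is applied to prefixes of large letters. -/
theorem cross_append_eq {s w ρ : List ℕ}
    (h1 : ∀ a ∈ s, ∀ b ∈ s ++ w, ∀ c ∈ ρ, ¬ (a < c ∧ c < b))
    (h2 : ∀ a ∈ s, invAbove a ρ = 0) : cross (s ++ w) ρ = cross w ρ := by
  induction s with
  | nil => rfl
  | cons a s ih =>
    rw [List.cons_append, cross, ih, h2 a (by simp), List.sum_eq_zero]
    · simp
    · intro x hx
      obtain ⟨b, hb, rfl⟩ := List.mem_map.1 hx
      rw [List.countP_eq_zero]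
      intro c hc
      simpa using h1 a (by simp) b (by simp [List.mem_append.1 hb]) c hc
    · exact fun a ha b hb c hc => h1 a (by simp [ha]) b (List.mem_cons_of_mem _ hb) c hc
    · exact fun a ha => h2 a (by simp [ha])

theorem occL_append_eq_add {σ ρ : List ℕ} (h1 : ∀ a ∈ σ, ∀ b ∈ σ, ∀ c ∈ ρ, ¬ (a < c ∧ c < b))
    (h2 : ∀ a ∈ σ, invAbove a ρ = 0) : occL (σ ++ ρ) = occL σ + occL ρ := by
  have := cross_append_eq (w := []) (by simpa using h1) h2
  rw [List.append_nil] at this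
  rw [occL_append, this, cross]; rfl

theorem invAbove_map {f : ℕ → ℕ} {a : ℕ} {l : List ℕ} {S : Set ℕ} (hf : StrictMonoOn f S)
    (ha : a ∈ S) (hl : ∀ b ∈ l, b ∈ S) : invAbove (f a) (l.map f) = invAbove a l := by
  induction l with
  | nil => rfl
  | cons b l ih =>
    rw [List.map_cons, invAbove, invAbove, ih fun b hb => hl b (by simp [hb]), List.countP_map]
    congr 1
    refine List.countP_congr fun c hc => ?_
    have hc' := hl c (by simp [hc])
    simp [hf.lt_iff_lt ha hc', hf.lt_iff_lt hc' (hl b (by simp))]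

theorem occL_map {f : ℕ → ℕ} {l : List ℕ} {S : Set ℕ} (hf : StrictMonoOn f S)
    (hl : ∀ b ∈ l, b ∈ S) : occL (l.map f) = occL l := by
  induction l with
  | nil => rfl
  | cons b l ih =>
    rw [List.map_cons, occL, occL, ih fun b hb => hl b (by simp [hb]),
      invAbove_map hf (hl b (by simp)) fun b hb => hl b (by simp [hb])]

theorem Alt.map {f : ℕ → ℕ} {S : Set ℕ} (hf : StrictMonoOn f S) :
    ∀ {l : List ℕ}, (∀ b ∈ l, b ∈ S) → Alt l → Alt (l.map f)
  | [], _, _ => trivial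
  | [_], _, _ => trivial
  | a :: b :: l, hl, h => by
    simp only [List.map_cons, Alt] at h ⊢
    refine ⟨hf (hl a (by simp)) (hl b (by simp)) h.1, ?_,
      Alt.map hf (fun c hc => hl c (by simp [hc])) h.2.2⟩
    match l with
    | [] => simp
    | c :: l =>
      have := hf (hl c (by simp)) (hl b (by simp)) (h.2.1 c (by simp))
      simpa using this

end AltPerm

/-! ### Alternating arrangements of a finite set, and the cut at the largest letter. -/

namespace AltPerm

open Classical in
/-- The alternating arrangements of the letters in `S`. -/
noncomputable def altWords (S : Finset ℕ) : Finset (List ℕ) :=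
  Finset.filter Alt ⟨S.val.lists, Multiset.lists_nodup_finset S⟩

theorem mem_altWords {S : Finset ℕ} {l : List ℕ} :
    l ∈ altWords S ↔ l.Nodup ∧ l.toFinset = S ∧ Alt l := by
  classical
  rw [altWords, Finset.mem_filter, Finset.mem_mk, Multiset.mem_lists_iff, ← and_assoc]
  refine and_congr_left fun _ => ⟨fun h => ?_, fun ⟨h1, h2⟩ => ?_⟩
  · have h1 : l.Nodup := by simpa [h] using S.nodup
    refine ⟨h1, ?_⟩
    ext a
    rw [List.mem_toFinset, ← Finset.mem_val, h]; simp
  · subst h2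
    rw [List.toFinset_val, h1.dedup]; rfl

theorem length_of_mem_altWords {S : Finset ℕ} {l : List ℕ} (h : l ∈ altWords S) :
    l.length = S.card := by
  obtain ⟨h1, rfl, -⟩ := mem_altWords.1 h
  exact (List.toFinset_card_of_nodup h1).symm

theorem mem_iff_of_mem_altWords {S : Finset ℕ} {l : List ℕ} (h : l ∈ altWords S) {a : ℕ} :
    a ∈ l ↔ a ∈ S := by
  obtain ⟨-, rfl, -⟩ := mem_altWords.1 h
  simp

theorem map_mem_altWords {S : Finset ℕ} {f : ℕ → ℕ} (hf : StrictMonoOn f S) {l : List ℕ}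
    (h : l ∈ altWords S) : l.map f ∈ altWords (S.image f) := by
  obtain ⟨h1, rfl, h3⟩ := mem_altWords.1 h
  refine mem_altWords.2 ⟨?_, ?_, h3.map hf (by simp)⟩
  · exact h1.map_on fun a ha b hb hab => hf.injOn (by simpa) (by simpa) hab
  · ext; simp

theorem sum_altWords_image {R : Type*} [AddCommMonoid R] {S : Finset ℕ} {f : ℕ → ℕ}
    (hf : StrictMonoOn f S) (φ : List ℕ → R) :
    ∑ l ∈ altWords (S.image f), φ l = ∑ l ∈ altWords S, φ (l.map f) := by
  symm
  have hg : ∀ a ∈ S, Function.invFunOn f S (f a) = a := fun a ha =>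
    hf.injOn (Function.invFunOn_mem ⟨a, ha, rfl⟩) ha (Function.invFunOn_eq ⟨a, ha, rfl⟩)
  have hmono : StrictMonoOn (Function.invFunOn f S) (S.image f : Finset ℕ) := by
    intro a ha b hb hab
    simp only [Finset.coe_image, Set.mem_image, Finset.mem_coe] at ha hb
    obtain ⟨a, ha, rfl⟩ := ha
    obtain ⟨b, hb, rfl⟩ := hb
    rw [hg a ha, hg b hb]
    exact (hf.lt_iff_lt ha hb).1 hab
  refine Finset.sum_nbij' (fun l => l.map f) (fun l => l.map (Function.invFunOn f S))
    (fun l hl => map_mem_altWords hf hl) (fun l hl => ?_) (fun l hl => ?_) (fun l hl => ?_)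
    (fun l hl => rfl)
  · have := map_mem_altWords hmono hl
    rwa [Finset.image_image, Finset.image_congr (g := id), Finset.image_id] at this
    exact fun a ha => hg a ha
  · rw [List.map_map, List.map_congr_left (g := id), List.map_id]
    exact fun b hb => hg b ((mem_iff_of_mem_altWords hl).1 hb)
  · rw [List.map_map, List.map_congr_left (g := id), List.map_id]
    intro a ha
    have := (mem_iff_of_mem_altWords hl).1 ha
    rw [Finset.mem_image] at this
    obtain ⟨a, this_mem, rfl⟩ := this
    exact congrArg f (hg a this_mem)

theorem exists_append_pair {l : List ℕ} (hl : Even l.length) (h : l ≠ []) :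
    ∃ s v y, l = s ++ [v, y] ∧ Even s.length := by
  obtain ⟨s, y, rfl⟩ := exists_append_singleton h
  obtain ⟨s, v, rfl⟩ := exists_append_singleton (l := s) (by rintro rfl; simp at hl)
  exact ⟨s, v, y, by simp, by simpa [parity_simps] using hl⟩

theorem exists_strictMonoOn_image_range (S : Finset ℕ) : ∃ f : ℕ → ℕ,
    StrictMonoOn f (Finset.range S.card) ∧ (Finset.range S.card).image f = S := by
  refine ⟨fun i => if h : i < S.card then S.orderEmbOfFin rfl ⟨i, h⟩ else 0, ?_, ?_⟩
  · intro a ha b hb hab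
    simp only [Finset.coe_range, Set.mem_Iio] at ha hb
    simpa [ha, hb] using hab
  · ext x
    simp only [Finset.mem_image, Finset.mem_range]
    constructor
    · rintro ⟨i, hi, rfl⟩
      simp [hi]
    · intro hx
      have : x ∈ Set.range (S.orderEmbOfFin rfl) := by simpa using hx
      obtain ⟨i, rfl⟩ := this
      exact ⟨i, i.2, by simp⟩

/-- Words split at their largest letter. -/
theorem sum_altWords_insert_max {R : Type*} [AddCommMonoid R] {S : Finset ℕ} {N : ℕ}
    (hN : ∀ a ∈ S, a < N) (hS : S.Nonempty) (φ : List ℕ → R) :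
    ∑ l ∈ altWords (insert N S), φ l = ∑ S₁ ∈ S.powerset with Odd S₁.card,
      ∑ σ ∈ altWords S₁, ∑ τ ∈ altWords (S \ S₁), φ (σ ++ N :: τ) := by
  simp_rw [← Finset.sum_product']
  rw [Finset.sum_sigma']
  symm
  have key : ∀ {S₁ σ τ}, S₁ ⊆ S → σ ∈ altWords S₁ → τ ∈ altWords (S \ S₁) → N ∉ σ ∧ N ∉ τ := by
    intro S₁ σ τ h hσ hτ
    rw [mem_iff_of_mem_altWords hσ, mem_iff_of_mem_altWords hτ, Finset.mem_sdiff]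
    exact ⟨fun H => (hN _ (h H)).false, fun H => (hN _ H.1).false⟩
  refine Finset.sum_bij (fun x _ => x.2.1 ++ N :: x.2.2) ?_ ?_ ?_ (fun _ _ => rfl)
  · rintro ⟨S₁, σ, τ⟩ h
    simp only [Finset.mem_sigma, Finset.mem_filter, Finset.mem_powerset, Finset.mem_product] at h
    obtain ⟨⟨h1, h2⟩, h3, h4⟩ := h
    have hk := key h1 h3 h4
    have hl := length_of_mem_altWords h3
    dsimp only at h1 h2 h3 h4 hk hl ⊢
    obtain ⟨hσ, rfl, h3'⟩ := mem_altWords.1 h3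
    obtain ⟨h4, h4', h4''⟩ := mem_altWords.1 h4
    have hlt : ∀ a ∈ σ, a < N := fun a ha => hN a (h1 (by simpa))
    have hgt : ∀ a, a ∈ τ ↔ a ∈ S ∧ a ∉ σ := fun a => by
      rw [← List.mem_toFinset, h4']; simp
    refine mem_altWords.2 ⟨?_, ?_, ?_⟩
    · rw [List.nodup_append, List.nodup_cons]
      refine ⟨hσ, ⟨hk.2, h4⟩, ?_⟩
      rintro a ha b hb rfl
      rcases List.mem_cons.1 hb with rfl | hb
      · exact hk.1 ha
      · exact ((hgt _).1 hb).2 ha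
    · ext a
      simp only [List.mem_toFinset, List.mem_append, List.mem_cons, hgt, Finset.mem_insert]
      have : a ∈ σ → a ∈ S := fun h => h1 (by simpa)
      tauto
    · obtain ⟨s, z, rfl⟩ := exists_append_singleton (l := σ) (by rintro rfl; simp at h2)
      rw [← hl] at h2
      rw [List.append_assoc, List.singleton_append, alt_append_max _ (hlt z (by simp))]
      · exact ⟨h3', h4''⟩
      · exact fun b hb => hN b ((hgt b).1 hb).1
      · simpa [parity_simps] using h2
  · rintro ⟨S₁, σ, τ⟩ h ⟨S₁', σ', τ'⟩ h' H
    simp only [Finset.mem_sigma, Finset.mem_filter, Finset.mem_powerset, Finset.mem_product] at h h'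
    have hk := key h.1.1 h.2.1 h.2.2
    have hk' := key h'.1.1 h'.2.1 h'.2.2
    have : σ = σ' ∧ τ = τ' := by
      have := (List.append_cons_inj_of_notMem hk.1 hk.2).1 H
      exact ⟨this.1, this.2.2⟩
    obtain ⟨rfl, rfl⟩ := this
    obtain ⟨-, rfl, -⟩ := mem_altWords.1 h.2.1
    obtain ⟨-, rfl, -⟩ := mem_altWords.1 h'.2.1
    rfl
  · intro l hl
    obtain ⟨h1, h2, h3⟩ := mem_altWords.1 hl
    have hmem : ∀ a, a ∈ l ↔ a = N ∨ a ∈ S := fun a => by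
      rw [← List.mem_toFinset, h2]; simp
    obtain ⟨σ, τ, rfl⟩ := List.append_of_mem ((hmem N).2 (by simp))
    rw [List.nodup_append, List.nodup_cons] at h1
    obtain ⟨hd1, ⟨hd2, hd3⟩, hd4⟩ := h1
    have hNσ : N ∉ σ := fun h => hd4 N h N (by simp) rfl
    have hσS : ∀ a ∈ σ, a ∈ S := fun a ha => ((hmem a).1 (by simp [ha])).resolve_left
      (by rintro rfl; exact hNσ ha)
    have hτS : ∀ a ∈ τ, a ∈ S := fun a ha => ((hmem a).1 (by simp [ha])).resolve_left
      (by rintro rfl; exact hd2 ha)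
    -- After an even prefix `N` would stand in a valley, below the next letter or below the
    -- preceding peak. Nonemptiness of `S` rules out the one-letter word, where `N` has no neighbour
    -- at all.
    have hodd : Odd σ.length := by
      by_contra hev
      rw [Nat.not_odd_iff_even] at hev
      have := (alt_append_of_even _ hev h3).2
      rcases eq_or_ne σ [] with rfl | hσ
      · match τ with
        | [] =>
          obtain ⟨a, ha⟩ := hS
          have := (hmem a).2 (Or.inr ha)
          simp only [List.nil_append, List.mem_singleton] at this
          exact (hN a ha).ne this
        | b :: τ => exact (hN b (hτS b (by simp))).not_gt this.1
      · obtain ⟨s, v, y, rfl, hs⟩ := exists_append_pair hev hσ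
        rw [List.append_assoc] at h3
        have := (alt_append_of_even _ hs h3).2.2.1 N (by simp)
        exact this.not_gt (hN y (hσS y (by simp)))
    have hA : Alt σ ∧ Alt τ := by
      obtain ⟨s, z, rfl⟩ := exists_append_singleton (l := σ) (by rintro rfl; simp at hodd)
      rw [List.append_assoc, List.singleton_append, alt_append_max _ (hN z (hσS z (by simp)))] at h3
      · exact h3
      · exact fun b hb => hN b (hτS b hb)
      · simpa [parity_simps] using hodd
    refine ⟨⟨σ.toFinset, σ, τ⟩, ?_, rfl⟩
    simp only [Finset.mem_sigma, Finset.mem_filter, Finset.mem_powerset, Finset.mem_product,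
      mem_altWords, List.toFinset_card_of_nodup hd1]
    refine ⟨⟨fun a ha => hσS a (by simpa using ha), hodd⟩, ⟨hd1, trivial, hA.1⟩, hd3, ?_, hA.2⟩
    ext a
    simp only [List.mem_toFinset, Finset.mem_sdiff]
    constructor
    · exact fun h => ⟨hτS a h, fun h' => hd4 a h' a (by simp [h]) rfl⟩
    · rintro ⟨ha, ha'⟩
      have := (hmem a).2 (Or.inr ha)
      have hne : a ≠ N := (hN a ha).ne
      simpa [ha', hne] using this

end AltPerm

/-! ### The three shapes of a word with at most three occurrences. -/

namespace AltPerm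

theorem occL_map_getD {c : List ℕ} (hc : c.Pairwise (· < ·)) {w : List ℕ}
    (hw : ∀ b ∈ w, b < c.length) : occL (w.map (c.getD · 0)) = occL w := by
  refine occL_map (S := {i | i < c.length}) ?_ hw
  intro i hi j hj hij
  simp only [Set.mem_ofPred_eq] at hi hj
  simpa [hi, hj] using List.pairwise_iff_getElem.1 hc i j hi hj hij

/-- A word in which the pattern `w` is formed by the letters `c` contains 1-3-2 at least as often as
`w` does. -/
theorem le_occL_of_sublist {l : List ℕ} (c w : List ℕ) (hc : c.Pairwise (· < ·))
    (hw : ∀ b ∈ w, b < c.length) (h : (w.map (c.getD · 0)).Sublist l) : occL w ≤ occL l := by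
  have := occL_le_of_sublist h
  rwa [occL_map_getD hc hw] at this

/-- The tool for every contradiction below: `c` lists the letters of a configuration in increasing
order, `w` gives their ranks in order of position, and `decide` checks that `w` already has at least
four occurrences. -/
theorem not_sublist_of_occL_lt {l c w : List ℕ} (hl : occL l < occL w) (hc : c.Pairwise (· < ·))
    (hw : ∀ b ∈ w, b < c.length) (h : (w.map (c.getD · 0)).Sublist l) : False :=
  hl.not_ge (le_occL_of_sublist c w hc hw h)

theorem exists_min_mem {l : List ℕ} (h : l ≠ []) : ∃ m ∈ l, ∀ a ∈ l, m ≤ a := by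
  obtain ⟨m, h1, h2⟩ := l.toFinset.exists_min_image id (by simpa using h)
  exact ⟨m, by simpa using h1, by simpa using h2⟩

theorem exists_max_mem {l : List ℕ} (h : l ≠ []) : ∃ m ∈ l, ∀ a ∈ l, a ≤ m := by
  obtain ⟨m, h1, h2⟩ := l.toFinset.exists_max_image id (by simpa using h)
  exact ⟨m, by simpa using h1, by simpa using h2⟩

theorem pair_sublist_or {l : List ℕ} {a b : ℕ} (ha : a ∈ l) (hb : b ∈ l) (h : a ≠ b) :
    [a, b].Sublist l ∨ [b, a].Sublist l := by
  obtain ⟨s, t, rfl⟩ := List.append_of_mem ha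
  simp only [List.mem_append, List.mem_cons, h.symm, false_or] at hb
  rcases hb with hb | hb
  · exact .inr ((List.singleton_sublist.2 hb).append
      (List.singleton_sublist.2 (List.mem_cons_self ..)))
  · exact .inl (((List.singleton_sublist.2 hb).cons_cons a).trans (List.sublist_append_right ..))

/-- The letters before the largest letter `N`, compared to those after it, when there are at most
three occurrences of 1-3-2. -/
theorem split_cases {σ τ : List ℕ} {N : ℕ} (hσ : Alt σ) (hodd : Odd σ.length)
    (hd : (σ ++ N :: τ).Nodup) (hNσ : ∀ a ∈ σ, a < N) (hNτ : ∀ a ∈ τ, a < N)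
    (hocc : occL (σ ++ N :: τ) ≤ 3) :
    (∀ a ∈ σ, ∀ b ∈ τ, b < a) ∨
    (∃ s m, σ = s ++ [m] ∧ (∀ a ∈ s, m < a) ∧ (∀ a ∈ s, ∀ b ∈ τ, b < a) ∧ ∃ b ∈ τ, m < b) ∨
    (∃ s v y m M, σ = s ++ [v, y, m] ∧ M ∈ τ ∧ m < v ∧ v < M ∧ v < y ∧
      (∀ b ∈ τ, b = M ∨ b < m) ∧ ∀ a ∈ s, M < a) := by
  rw [or_iff_not_imp_left]
  intro hA
  push Not at hA
  obtain ⟨a₀, ha₀, b₀, hb₀, hab₀⟩ := hA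
  rw [List.nodup_append] at hd
  obtain ⟨hdσ, hdτ, hne⟩ := hd
  have hne : ∀ a ∈ σ, ∀ b ∈ τ, a ≠ b := fun a ha b hb => hne a ha b (by simp [hb])
  obtain ⟨M, hM, hM'⟩ := exists_max_mem (List.ne_nil_of_mem hb₀)
  obtain ⟨m, hm, hm'⟩ := exists_min_mem (List.ne_nil_of_mem ha₀)
  have hmM : m < M := lt_of_le_of_ne ((hm' _ ha₀).trans (hab₀.trans (hM' _ hb₀))) (hne _ hm _ hM)
  obtain ⟨s, z, rfl⟩ := exists_append_singleton (List.ne_nil_of_mem ha₀)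
  have hs : Even s.length := by simpa [parity_simps] using hodd
  have hsub2 : ∀ {t t' : List ℕ}, t.Sublist (s ++ [z]) → t'.Sublist τ →
      (t ++ N :: t').Sublist (s ++ [z] ++ N :: τ) := fun h h' => h.append (h'.cons_cons N)
  have hM1 : [M].Sublist τ := List.singleton_sublist.2 hM
  have hMN := hNτ M hM
  -- If the minimum came before the last letter `z`, then it, the last peak `u`, `z`, `N` and `M`
  -- would form at least four occurrences, wherever `M` lies relative to `u` and `z`.
  have hmz : m = z := by
    by_contra hmz
    have hms : m ∈ s := by simpa [hmz] using hm
    obtain ⟨s, w, u, rfl, hs'⟩ := exists_append_pair hs (List.ne_nil_of_mem hms)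
    rw [List.append_assoc] at hσ
    obtain ⟨hwu, hzu, -⟩ := (alt_append_of_even _ hs' hσ).2
    replace hzu : z < u := hzu z (by simp)
    have hmw := hm' w (by simp)
    have hmu : m ≠ u := by omega
    have hsub : [m, u, z].Sublist (s ++ [w, u] ++ [z]) := by
      have : m ∈ s ++ [w] := by simpa [hmu] using hms
      have := (List.singleton_sublist.2 this).append (List.Sublist.refl [u, z])
      simpa using this
    have H := hsub2 hsub hM1
    have huN := hNσ u (by simp)
    have hmz' : m < z := lt_of_le_of_ne (hm' z (by simp)) hmz
    have h1 := hne u (by simp) M hM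
    have h2 := hne z (by simp) M hM
    rcases lt_or_gt_of_ne h1 with h1 | h1
    · exact not_sublist_of_occL_lt (c := [m, z, u, M, N]) (w := [0, 2, 1, 4, 3])
        (hocc.trans_lt (by decide)) (by simp; omega) (by simp) H
    rcases lt_or_gt_of_ne h2 with h2 | h2
    · exact not_sublist_of_occL_lt (c := [m, z, M, u, N]) (w := [0, 3, 1, 4, 2])
        (hocc.trans_lt (by decide)) (by simp; omega) (by simp) H
    · exact not_sublist_of_occL_lt (c := [m, M, z, u, N]) (w := [0, 3, 2, 4, 1])
        (hocc.trans_lt (by decide)) (by simp; omega) (by simp) H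
  subst hmz
  have hms : m ∉ s := fun h => by
    rw [List.nodup_append] at hdσ
    exact hdσ.2.2 m h m (by simp) rfl
  have hms' : ∀ a ∈ s, m < a := fun a ha =>
    lt_of_le_of_ne (hm' a (by simp [ha])) (by rintro rfl; exact hms ha)
  -- This separates the second shape from the third: in the third, some letter of `σ` other than `m`
  -- is also below `M`.
  by_cases hB : ∀ a ∈ s, ∀ b ∈ τ, b < a
  · exact .inl ⟨s, m, rfl, hms', hB, M, hM, hmM⟩
  push Not at hB
  obtain ⟨a₁, ha₁, b₁, hb₁, hab₁⟩ := hB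
  obtain ⟨v, hv, hv'⟩ := exists_min_mem (List.ne_nil_of_mem ha₁)
  have hvM : v < M := lt_of_le_of_ne ((hv' _ ha₁).trans (hab₁.trans (hM' _ hb₁)))
    (hne _ (by simp [hv]) _ hM)
  obtain ⟨s, w, y, rfl, hs'⟩ := exists_append_pair hs (List.ne_nil_of_mem ha₁)
  rw [List.append_assoc] at hσ
  obtain ⟨hwy, -, -⟩ := (alt_append_of_even _ hs' hσ).2
  have hmv := hms' v hv
  have hyM := hne y (by simp) M hM
  have hyN := hNσ y (by simp)
  -- The smallest letter of `σ` other than `m` must be the valley next to last; otherwise `v`, `w`,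
  -- `m` with `N`, `M`, together with `y`, give too many occurrences.
  have hvw : v = w := by
    by_contra hvw
    have hvw' : v < w := lt_of_le_of_ne (hv' w (by simp)) hvw
    have hvy : v ≠ y := by omega
    have hvs : v ∈ s := by simpa [hvw, hvy] using hv
    have H := hsub2 (t := [v, w, y, m]) (by
      have := (List.singleton_sublist.2 hvs).append (List.Sublist.refl [w, y, m])
      simpa using this) hM1
    have hwM := hne w (by simp) M hM
    rcases lt_or_gt_of_ne hyM with h1 | h1
    · exact not_sublist_of_occL_lt (c := [m, v, w, y, M, N]) (w := [1, 2, 3, 0, 5, 4])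
        (hocc.trans_lt (by decide)) (by simp; omega) (by simp) H
    rcases lt_or_gt_of_ne hwM with h2 | h2
    · exact not_sublist_of_occL_lt (c := [m, v, w, M, y, N]) (w := [1, 2, 4, 0, 5, 3])
        (hocc.trans_lt (by decide)) (by simp; omega) (by simp) H
    · exact not_sublist_of_occL_lt (c := [m, v, M, w, y, N]) (w := [1, 3, 4, 0, 5, 2])
        (hocc.trans_lt (by decide)) (by simp; omega) (by simp) H
  subst hvw
  have hvs : ∀ a ∈ s, v < a := fun a ha => lt_of_le_of_ne (hv' a (by simp [ha])) (by
    rintro rfl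
    rw [List.append_assoc, List.nodup_append] at hdσ
    exact hdσ.2.2 v ha v (by simp) rfl)
  refine .inr ⟨s, v, y, m, M, by simp, hM, hmv, hvM, hwy, ?_, ?_⟩
  -- A second letter `b` of `τ` above `m` is impossible: the configurations run over the order of
  -- `b` and `M` in `τ` and the rank of `b` and `M` among `v`, `y`.
  · intro b hb
    rw [or_iff_not_imp_left]
    intro hbM
    by_contra! hmb
    have hbM' : b < M := lt_of_le_of_ne (hM' b hb) hbM
    have hmb' : m < b := lt_of_le_of_ne hmb (hne m (by simp) b hb)
    have hvb := hne v (by simp) b hb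
    have hyb := hne y (by simp) b hb
    have hsub : [v, y, m].Sublist (s ++ [v, y] ++ [m]) := by simp
    rcases pair_sublist_or hb hM hbM with hbM' | hbM'
    all_goals
      have H := hsub2 hsub hbM'
      rcases lt_or_gt_of_ne hyM with h1 | h1 <;> rcases lt_or_gt_of_ne hvb with h2 | h2 <;>
        rcases lt_or_gt_of_ne hyb with h3 | h3
    · exact not_sublist_of_occL_lt (c := [m, v, y, b, M, N]) (w := [1, 2, 0, 5, 3, 4])
        (hocc.trans_lt (by decide)) (by simp; omega) (by simp) H
    · exact not_sublist_of_occL_lt (c := [m, v, b, y, M, N]) (w := [1, 3, 0, 5, 2, 4])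
        (hocc.trans_lt (by decide)) (by simp; omega) (by simp) H
    · omega
    · exact not_sublist_of_occL_lt (c := [m, b, v, y, M, N]) (w := [2, 3, 0, 5, 1, 4])
        (hocc.trans_lt (by decide)) (by simp; omega) (by simp) H
    · omega
    · exact not_sublist_of_occL_lt (c := [m, v, b, M, y, N]) (w := [1, 4, 0, 5, 2, 3])
        (hocc.trans_lt (by decide)) (by simp; omega) (by simp) H
    · omega
    · exact not_sublist_of_occL_lt (c := [m, b, v, M, y, N]) (w := [2, 4, 0, 5, 1, 3])
        (hocc.trans_lt (by decide)) (by simp; omega) (by simp) H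
    · exact not_sublist_of_occL_lt (c := [m, v, y, b, M, N]) (w := [1, 2, 0, 5, 4, 3])
        (hocc.trans_lt (by decide)) (by simp; omega) (by simp) H
    · exact not_sublist_of_occL_lt (c := [m, v, b, y, M, N]) (w := [1, 3, 0, 5, 4, 2])
        (hocc.trans_lt (by decide)) (by simp; omega) (by simp) H
    · omega
    · exact not_sublist_of_occL_lt (c := [m, b, v, y, M, N]) (w := [2, 3, 0, 5, 4, 1])
        (hocc.trans_lt (by decide)) (by simp; omega) (by simp) H
    · omega
    · exact not_sublist_of_occL_lt (c := [m, v, b, M, y, N]) (w := [1, 4, 0, 5, 3, 2])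
        (hocc.trans_lt (by decide)) (by simp; omega) (by simp) H
    · omega
    · exact not_sublist_of_occL_lt (c := [m, b, v, M, y, N]) (w := [2, 4, 0, 5, 3, 1])
        (hocc.trans_lt (by decide)) (by simp; omega) (by simp) H
  -- A third letter of `σ` at or before the valley below `M`, besides `v` and `m`, would again
  -- produce four occurrences.
  · intro a ha
    by_contra! haM
    have haM' : a < M := lt_of_le_of_ne haM (hne a (by simp [ha]) M hM)
    have hva := hvs a ha
    have H := hsub2 (t := [a, v, y, m]) (by
      have := (List.singleton_sublist.2 ha).append (List.Sublist.refl [v, y, m])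
      simpa using this) hM1
    have hay : a ≠ y := by
      rintro rfl
      rw [List.append_assoc, List.nodup_append] at hdσ
      exact hdσ.2.2 a ha a (by simp) rfl
    rcases lt_or_gt_of_ne hyM with h1 | h1
    · rcases lt_or_gt_of_ne hay with h2 | h2
      · exact not_sublist_of_occL_lt (c := [m, v, a, y, M, N]) (w := [2, 1, 3, 0, 5, 4])
          (hocc.trans_lt (by decide)) (by simp; omega) (by simp) H
      · exact not_sublist_of_occL_lt (c := [m, v, y, a, M, N]) (w := [3, 1, 2, 0, 5, 4])
          (hocc.trans_lt (by decide)) (by simp; omega) (by simp) H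
    · exact not_sublist_of_occL_lt (c := [m, v, a, M, y, N]) (w := [2, 1, 4, 0, 5, 3])
        (hocc.trans_lt (by decide)) (by simp; omega) (by simp) H

end AltPerm

/-! ### Counting occurrences in each shape; weights. -/

namespace AltPerm

theorem invAbove_eq_zero_of_unique {a M : ℕ} {l : List ℕ} (h : ∀ c ∈ l, c ≤ a ∨ c = M) :
    invAbove a l = 0 := by
  induction l with
  | nil => rfl
  | cons b l ih =>
    rw [invAbove, ih fun c hc => h c (by simp [hc]), add_zero, List.countP_eq_zero]
    intro c hc
    have := h c (by simp [hc])
    have := h b (by simp)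
    simp only [decide_eq_true_eq]; omega

theorem countP_eq_card {S : Finset ℕ} {l : List ℕ} (h : l ∈ altWords S) (p : ℕ → Prop)
    [DecidablePred p] : l.countP (fun c => p c) = (S.filter p).card := by
  obtain ⟨h1, rfl, -⟩ := mem_altWords.1 h
  rw [List.countP_eq_length_filter, ← List.toFinset_card_of_nodup (h1.filter _),
    List.toFinset_filter]
  simp

theorem occL_max_cons {N : ℕ} {τ : List ℕ} (h : ∀ b ∈ τ, b < N) : occL (N :: τ) = occL τ := by
  rw [occL, invAbove_eq_zero fun c hc => (h c hc).le, zero_add]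

theorem occL_split_of_gt {σ τ : List ℕ} {N : ℕ} (h : ∀ a ∈ σ, ∀ b ∈ τ, b < a)
    (hσ : ∀ a ∈ σ, a < N) (hτ : ∀ a ∈ τ, a < N) :
    occL (σ ++ N :: τ) = occL σ + occL τ := by
  rw [occL_append_eq_add, occL_max_cons hτ]
  · intro a ha b hb c hc
    have := hσ b hb
    rcases List.mem_cons.1 hc with rfl | hc
    · omega
    · have := h a ha c hc; omega
  · exact fun a ha => invAbove_cons_eq_zero fun c hc => (h a ha c hc).le

/-- The mixed occurrences all start with `p`: `p N c` for each letter `c` of `τ` above `p`, and `p b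
c` for each descent `b … c` of `τ` above `p`. -/
theorem occL_split_of_min {s τ : List ℕ} {p N : ℕ} (hps : ∀ a ∈ s, p < a)
    (h : ∀ a ∈ s, ∀ b ∈ τ, b < a) (hs : ∀ a ∈ s, a < N) (hτ : ∀ a ∈ τ, a < N) :
    occL (s ++ [p] ++ N :: τ) =
      occL s + (τ.countP (fun c => p < c) + invAbove p τ + occL τ) := by
  rw [List.append_assoc, occL_append_eq_add]
  · rw [List.singleton_append, occL, occL_max_cons hτ, invAbove]
    have : (τ.countP fun c => p < c ∧ c < N) = τ.countP (fun c => p < c) :=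
      List.countP_congr fun c hc => by simp [hτ c hc]
    omega
  · intro a ha b hb c hc
    have := hs b hb
    have := hps a ha
    simp only [List.singleton_append, List.mem_cons] at hc
    rcases hc with rfl | rfl | hc
    · omega
    · omega
    · have := h a ha c hc; omega
  · intro a ha
    rw [List.singleton_append, invAbove, invAbove_cons_eq_zero fun c hc => (h a ha c hc).le,
      add_zero, List.countP_eq_zero]
    intro c _
    have := hps a ha
    simp only [decide_eq_true_eq]; omega

/-- The three mixed occurrences are `m N M`, `v N M`, and either `y N M` or `v y M`, according to
whether `y < M` or `M < y`. -/
theorem occL_split_of_three {s τ : List ℕ} {v y m M N : ℕ} (hτn : τ.Nodup) (hMτ : M ∈ τ)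
    (hmv : m < v) (hvM : v < M) (hvy : v < y) (hyM : y ≠ M) (hyN : y < N)
    (h : ∀ b ∈ τ, b = M ∨ b < m) (hs : ∀ a ∈ s, M < a) (hsN : ∀ a ∈ s, a < N)
    (hτ : ∀ b ∈ τ, b < N) :
    occL (s ++ [v, y, m] ++ N :: τ) = occL (s ++ [v, y, m]) + 3 + occL τ := by
  have hMN := hτ M hMτ
  rw [occL_append, occL_max_cons hτ, cross_append_eq]
  · have hcount : ∀ a b, m ≤ a → a < M → M < b → τ.countP (fun c => a < c ∧ c < b) = 1 := by
      intro a b hma haM hMb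
      rw [← List.count_eq_one_of_mem hτn hMτ, List.count]
      refine List.countP_congr fun c hc => ?_
      have := h c hc
      simp only [decide_eq_true_eq, beq_iff_eq]
      omega
    have hcount' : ∀ a b, m ≤ a → (M ≤ a ∨ b ≤ M) → τ.countP (fun c => a < c ∧ c < b) = 0 := by
      intro a b hma hb
      rw [List.countP_eq_zero]
      intro c hc
      have := h c hc
      simp only [decide_eq_true_eq]
      omega
    have hinv : ∀ a, m ≤ a → invAbove a τ = 0 := fun a ha =>
      invAbove_eq_zero_of_unique (M := M) fun c hc => by have := h c hc; omega
    simp only [cross, invAbove, List.map_cons, List.map_nil, List.sum_cons, List.sum_nil,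
      List.countP_cons]
    rw [hinv v (by omega), hinv y (by omega), hinv m (by omega), hcount v N (by omega) hvM hMN,
      hcount m N le_rfl (by omega) hMN, hcount' v m (by omega) (by omega),
      hcount' y m (by omega) (by omega)]
    have e1 : decide (v < N ∧ N < y) = false := by simp; omega
    have e2 : decide (v < N ∧ N < m) = false := by simp; omega
    have e3 : decide (y < N ∧ N < m) = false := by simp; omega
    rw [e1, e2, e3]
    rcases lt_or_gt_of_ne hyM with hy | hy
    · rw [hcount' v y (by omega) (by omega), hcount y N (by omega) hy hMN]; simp
    · rw [hcount v y (by omega) hvM hy, hcount' y N (by omega) (by omega)]; simp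
  · intro a ha b hb c hc
    have hbN : b < N := by
      simp only [List.mem_append, List.mem_cons, List.not_mem_nil, or_false] at hb
      rcases hb with hb | rfl | rfl | rfl
      · exact hsN b hb
      all_goals omega
    have := hs a ha
    rcases List.mem_cons.1 hc with rfl | hc
    · omega
    · have := h c hc; omega
  · intro a ha
    refine invAbove_cons_eq_zero fun c hc => ?_
    have := hs a ha
    have := h c hc
    omega

/-- Words with a prescribed suffix of small letters. -/
theorem sum_altWords_suffix {R : Type*} [AddCommMonoid R] {T S : Finset ℕ} {w : List ℕ}
    (hS : S = T ∪ w.toFinset) (hT : Even T.card) (hw : Alt w) (hwn : w.Nodup)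
    (hTw : ∀ a ∈ T, ∀ b ∈ w, b < a) {φ : List ℕ → R}
    (hφ : ∀ σ ∈ altWords S, (∀ s, σ ≠ s ++ w) → φ σ = 0) :
    ∑ σ ∈ altWords S, φ σ = ∑ s ∈ altWords T, φ (s ++ w) := by
  subst hS
  symm
  refine Finset.sum_of_injOn (· ++ w) (List.append_left_injective w).injOn ?_ ?_ (fun _ _ => rfl)
  · intro s hs
    obtain ⟨h1, rfl, h3⟩ := mem_altWords.1 hs
    simp only [List.mem_toFinset] at hTw
    refine mem_altWords.2 ⟨?_, by simp, h3.append hw ?_ ?_⟩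
    · exact h1.append hwn fun a ha hb => (hTw a ha a hb).false
    · rwa [List.toFinset_card_of_nodup h1] at hT
    · exact fun a ha b hb => hTw a ha b (List.mem_of_mem_head? hb)
  · intro σ hσ h
    refine hφ σ hσ ?_
    rintro s rfl
    refine h ⟨s, ?_, rfl⟩
    obtain ⟨h1, h2, h3⟩ := mem_altWords.1 hσ
    rw [List.nodup_append] at h1
    have hsT : s.toFinset = T := by
      ext a
      have := Finset.ext_iff.1 h2 a
      simp only [List.toFinset_append, Finset.mem_union, List.mem_toFinset] at this ⊢
      have h4 : a ∈ s → a ∉ w := fun ha hb => h1.2.2 a ha a hb rfl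
      have h5 : a ∈ T → a ∉ w := fun ha hb => (hTw a ha a hb).false
      tauto
    refine mem_altWords.2 ⟨h1.1, hsT, (alt_append_of_even w ?_ h3).1⟩
    rwa [← hsT, List.toFinset_card_of_nodup h1.1] at hT

section weight
variable {R : Type*} [CommRing R] (q : R)

/-- The generating polynomial of the alternating words on `S` by occurrences of 1-3-2. -/
noncomputable def wt (S : Finset ℕ) : R := ∑ l ∈ altWords S, q ^ occL l

/-- The weight of all alternating words on `insert N S₁ ∪ S₂` in which the letters before `N` are
those in `S₁`. -/
noncomputable def splitWt (S₁ S₂ : Finset ℕ) (N : ℕ) : R :=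
  ∑ σ ∈ altWords S₁, ∑ τ ∈ altWords S₂, q ^ occL (σ ++ N :: τ)

theorem sum_altWords_eq_range {R : Type*} [AddCommMonoid R] (S : Finset ℕ) (φ : List ℕ → R)
    (hφ : ∀ l ∈ altWords (Finset.range S.card), ∀ f : ℕ → ℕ, 
      StrictMonoOn f (Finset.range S.card) → φ (l.map f) = φ l) :
    ∑ l ∈ altWords S, φ l = ∑ l ∈ altWords (Finset.range S.card), φ l := by
  obtain ⟨f, hf, hS⟩ := exists_strictMonoOn_image_range S
  conv_lhs => rw [← hS, sum_altWords_image hf]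
  exact Finset.sum_congr rfl fun l hl => hφ l hl f hf

/-- Order-preserving relabelling changes neither alternation nor occurrences, so a weight depends
only on the number of letters. -/
theorem wt_eq (S : Finset ℕ) : wt q S = wt q (Finset.range S.card) :=
  sum_altWords_eq_range S _ fun l hl f hf => by
    rw [occL_map hf fun b hb => (mem_iff_of_mem_altWords hl).1 hb]

theorem splitWt_of_gt {S₁ S₂ : Finset ℕ} {N : ℕ} (h : ∀ a ∈ S₁, ∀ b ∈ S₂, b < a)
    (h1 : ∀ a ∈ S₁, a < N) (h2 : ∀ a ∈ S₂, a < N) : splitWt q S₁ S₂ N = wt q S₁ * wt q S₂ := by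
  rw [splitWt, wt, wt, Finset.sum_mul_sum]
  refine Finset.sum_congr rfl fun σ hσ => Finset.sum_congr rfl fun τ hτ => ?_
  simp_rw [← mem_iff_of_mem_altWords hσ, ← mem_iff_of_mem_altWords hτ] at h h1 h2
  rw [occL_split_of_gt h h1 h2, pow_add]

end weight

end AltPerm

/-! ### Weights of the two shapes in which some letter before the maximum is below a later one. -/

namespace AltPerm

variable {R : Type*} [CommRing R] {q : R}

theorem split_cases_of_mem {S₁ S₂ : Finset ℕ} {N : ℕ} (hd : Disjoint S₁ S₂) (hodd : Odd S₁.card)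
    (h1 : ∀ a ∈ S₁, a < N) (h2 : ∀ a ∈ S₂, a < N) {σ τ : List ℕ} (hσ : σ ∈ altWords S₁)
    (hτ : τ ∈ altWords S₂) (hocc : occL (σ ++ N :: τ) ≤ 3) :
    (∀ a ∈ S₁, ∀ b ∈ S₂, b < a) ∨
    (∃ s m, σ = s ++ [m] ∧ (∀ a ∈ s, m < a) ∧ (∀ a ∈ s, ∀ b ∈ S₂, b < a) ∧ ∃ b ∈ S₂, m < b) ∨
    (∃ s v y m M, σ = s ++ [v, y, m] ∧ M ∈ S₂ ∧ m < v ∧ v < M ∧ v < y ∧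
      (∀ b ∈ S₂, b = M ∨ b < m) ∧ ∀ a ∈ s, M < a) := by
  rw [← length_of_mem_altWords hσ] at hodd
  have hd' : ∀ a ∈ S₁, a ∉ S₂ := fun a h => Finset.disjoint_left.1 hd h
  simp_rw [← mem_iff_of_mem_altWords hσ, ← mem_iff_of_mem_altWords hτ] at h1 h2 hd' ⊢
  refine split_cases (mem_altWords.1 hσ).2.2 hodd ?_ h1 h2 hocc
  rw [List.nodup_append, List.nodup_cons]
  refine ⟨(mem_altWords.1 hσ).1, ⟨fun h => (h2 _ h).false, (mem_altWords.1 hτ).1⟩, ?_⟩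
  rintro a ha b hb rfl
  rcases List.mem_cons.1 hb with rfl | hb
  · exact (h1 _ ha).false
  · exact hd' _ ha hb

/-- Only words with `p` directly before `N` survive `q ^ 4 = 0`. The first shape fails because `p`
is below `b`, and the third would need two letters of `σ` below a letter of `S₂`, while `p` is the
only one. -/
theorem splitWt_of_min (hq : q ^ 4 = 0) {T S₂ : Finset ℕ} {p N : ℕ} (hT : Even T.card)
    (hpT : ∀ a ∈ T, p < a) (h : ∀ a ∈ T, ∀ b ∈ S₂, b < a) (hp : p ∉ S₂) (hp' : ∃ b ∈ S₂, p < b)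
    (h1 : ∀ a ∈ T, a < N) (h2 : ∀ a ∈ S₂, a < N) :
    splitWt q (insert p T) S₂ N = wt q T *
      ∑ τ ∈ altWords S₂, q ^ ((S₂.filter (p < ·)).card + invAbove p τ + occL τ) := by
  obtain ⟨b, hb, hpb⟩ := hp'
  have hpN := h2 b hb
  have hpT' : p ∉ T := fun h => (hpT p h).false
  rw [splitWt, sum_altWords_suffix (T := T) (w := [p]), wt, Finset.sum_mul_sum]
  · refine Finset.sum_congr rfl fun s hs => Finset.sum_congr rfl fun τ hτ => ?_
    rw [← countP_eq_card hτ]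
    simp_rw [← mem_iff_of_mem_altWords hs, ← mem_iff_of_mem_altWords hτ] at h hpT h1 h2
    rw [occL_split_of_min hpT h h1 h2, pow_add]
  · ext a; simp
  · exact hT
  · trivial
  · simp
  · simpa using hpT
  · intro σ hσ hne
    refine Finset.sum_eq_zero fun τ hτ => pow_eq_zero_of_le (m := 4) ?_ hq
    by_contra! hocc
    have hmem : ∀ a, a ∈ σ ↔ a = p ∨ a ∈ T := fun a => by
      rw [mem_iff_of_mem_altWords hσ, Finset.mem_insert]
    have hdisj : Disjoint (insert p T) S₂ := by
      rw [Finset.disjoint_left]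
      intro a ha ha'
      rcases Finset.mem_insert.1 ha with rfl | ha
      · exact hp ha'
      · exact (h a ha a ha').false
    have hodd : Odd (insert p T).card := by
      rw [Finset.card_insert_of_notMem hpT']; exact hT.add_one
    have hlt : ∀ a ∈ insert p T, a < N := by
      simpa using ⟨hpb.trans hpN, h1⟩
    rcases split_cases_of_mem hdisj hodd hlt h2 hσ hτ (by omega) with H | H | H
    · exact (H p (by simp) b hb).not_gt hpb
    · obtain ⟨s, m, rfl, h3, h4, -⟩ := H
      have := (hmem p).2 (.inl rfl)
      rw [List.mem_append, List.mem_singleton] at this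
      rcases this with H | rfl
      · exact (h4 p H b hb).not_gt hpb
      · exact hne s rfl
    · obtain ⟨s, v, y, m, M, rfl, h3, h4, h5, -⟩ := H
      have hv := (hmem v).1 (by simp)
      have hm := (hmem m).1 (by simp)
      have hv' : v = p := hv.resolve_right fun hv => (h v hv M h3).not_gt h5
      have hm' : m = p := hm.resolve_right fun hv => (h m hv M h3).not_gt (h4.trans h5)
      omega

/-- The weight of the words on `S` that end with a valley `v`, a letter, and `m`. -/
noncomputable def valleyWt (q : R) (S : Finset ℕ) (v m : ℕ) : R := by
  classical exact ∑ σ ∈ altWords S, if ∃ s y, σ = s ++ [v, y, m] then q ^ occL σ else 0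

/-- Here `m` and `v` are the only letters of `σ` below `M`, so the letter `y` between them lies
above `M`. It stays undetermined, and the factor for `σ` is a valley weight rather than a product.
-/
theorem splitWt_of_two (hq : q ^ 4 = 0) {T S₂ : Finset ℕ} {m v M N : ℕ} (hT : Odd T.card)
    (hmv : m < v) (hvM : v < M) (hM : M ∈ S₂) (h : ∀ b ∈ S₂, b = M ∨ b < m) (hTM : ∀ a ∈ T, M < a)
    (h1 : ∀ a ∈ T, a < N) (h2 : ∀ a ∈ S₂, a < N) :
    splitWt q (insert m (insert v T)) S₂ N =
      q ^ 3 * (valleyWt q (insert m (insert v T)) v m * wt q S₂) := by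
  have hvT : v ∉ T := fun h => by have := hTM v h; omega
  have hmT : m ∉ T := fun h => by have := hTM m h; omega
  rw [splitWt, valleyWt, wt, Finset.sum_mul_sum, Finset.mul_sum]
  refine Finset.sum_congr rfl fun σ hσ => ?_
  rw [Finset.mul_sum]
  refine Finset.sum_congr rfl fun τ hτ => ?_
  have hmem : ∀ a, a ∈ σ ↔ a = m ∨ a = v ∨ a ∈ T := fun a => by
    rw [mem_iff_of_mem_altWords hσ, Finset.mem_insert, Finset.mem_insert]
  have hMN := h2 M hM
  split_ifs with H
  · obtain ⟨s, y, rfl⟩ := H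
    obtain ⟨hn, -⟩ := mem_altWords.1 hσ
    have hvals : ∀ a ∈ s ++ [y], a ∈ T := by
      intro a ha
      have := (hmem a).1 (by simp at ha ⊢; tauto)
      simp only [List.nodup_append, List.nodup_cons, List.mem_cons] at hn
      simp only [List.mem_append, List.mem_singleton] at ha
      rcases this with rfl | rfl | h
      · rcases ha with ha | rfl
        · exact absurd rfl (hn.2.2 a ha a (by simp))
        · simp at hn
      · rcases ha with ha | rfl
        · exact absurd rfl (hn.2.2 a ha a (by simp))
        · simp at hn
      · exact h
    have hy := hvals y (by simp)
    have hyM := hTM y hy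
    simp_rw [← mem_iff_of_mem_altWords hτ] at h hM h2
    rw [occL_split_of_three (mem_altWords.1 hτ).1 hM hmv hvM (by omega) (by omega) (h1 y hy) h
      (fun a ha => hTM a (hvals a (by simp [ha]))) (fun a ha => h1 a (hvals a (by simp [ha]))) h2]
    ring
  · rw [zero_mul, mul_zero]
    refine pow_eq_zero_of_le (m := 4) ?_ hq
    by_contra! hocc
    have hlow : ∀ a ∈ σ, ∀ b ∈ S₂, a < b → a = m ∨ a = v := by
      intro a ha b hb hab
      rcases (hmem a).1 ha with rfl | rfl | ha
      · simp
      · simp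
      · have := hTM a ha
        have := h b hb
        omega
    have hdisj : Disjoint (insert m (insert v T)) S₂ := by
      rw [Finset.disjoint_left]
      intro a ha ha'
      have := h a ha'
      simp only [Finset.mem_insert] at ha
      rcases ha with rfl | rfl | ha
      · omega
      · omega
      · have := hTM a ha; omega
    have hodd : Odd (insert m (insert v T)).card := by
      rw [Finset.card_insert_of_notMem (by simp [hmT, hmv.ne]), Finset.card_insert_of_notMem hvT]
      simpa [parity_simps] using hT
    have hlt : ∀ a ∈ insert m (insert v T), a < N := by
      simp only [Finset.mem_insert]
      rintro a (rfl | rfl | ha)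
      · omega
      · omega
      · exact h1 a ha
    -- In the second shape both `v` and `m` would have to be the last letter; in the third, the
    -- ending is forced to be `v`, a letter, `m`.
    rcases split_cases_of_mem hdisj hodd hlt h2 hσ hτ (by omega) with H' | H' | H'
    · have := H' m (by simp) M hM
      omega
    · obtain ⟨s, z, rfl, h3, h4, -⟩ := H'
      have hv := (hmem v).2 (by simp)
      have hm := (hmem m).2 (by simp)
      rw [List.mem_append, List.mem_singleton] at hv hm
      have : v ∉ s := fun hv => by have := h4 v hv M hM; omega
      have : m ∉ s := fun hv => by have := h4 m hv M hM; omega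
      have := hv.resolve_left ‹_›
      have := hm.resolve_left ‹_›
      omega
    · obtain ⟨s, v', y, m', M', rfl, h3, h4, h5, -⟩ := H'
      have hv := hlow v' (by simp) M' h3 h5
      have hm := hlow m' (by simp) M' h3 (h4.trans h5)
      obtain ⟨rfl, rfl⟩ : v' = v ∧ m' = m := by omega
      exact H ⟨s, y, rfl⟩

/-- When `y < M` as well, the ending `v y m` is completely determined by the letter set. It contains
no occurrence and lies below the rest of `σ`, so that factor is simply `wt q T`. -/
theorem splitWt_of_three (hq : q ^ 4 = 0) {T S₂ : Finset ℕ} {m v y M N : ℕ} (hT : Even T.card)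
    (hmv : m < v) (hvy : v < y) (hyM : y < M) (hM : M ∈ S₂) (h : ∀ b ∈ S₂, b = M ∨ b < m)
    (hTM : ∀ a ∈ T, M < a) (h1 : ∀ a ∈ T, a < N) (h2 : ∀ a ∈ S₂, a < N) :
    splitWt q (insert m (insert v (insert y T))) S₂ N = q ^ 3 * (wt q T * wt q S₂) := by
  have hvT : v ∉ T := fun h => by have := hTM v h; omega
  have hmT : m ∉ T := fun h => by have := hTM m h; omega
  have hyT : y ∉ T := fun h => by have := hTM y h; omega
  have hMN := h2 M hM
  rw [splitWt, sum_altWords_suffix (T := T) (w := [v, y, m]), wt, wt, Finset.sum_mul_sum,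
    Finset.mul_sum]
  · refine Finset.sum_congr rfl fun s hs => ?_
    rw [Finset.mul_sum]
    refine Finset.sum_congr rfl fun τ hτ => ?_
    simp_rw [← mem_iff_of_mem_altWords hτ] at h hM h2
    simp_rw [← mem_iff_of_mem_altWords hs] at hTM h1
    rw [occL_split_of_three (mem_altWords.1 hτ).1 hM hmv (by omega) hvy (by omega) (by omega) h
      hTM h1 h2, occL_append_eq_add]
    · have : occL [v, y, m] = 0 := by
        simp only [occL, invAbove, List.countP_cons, List.countP_nil]
        have : ¬ v < m := by omega
        simp [this]
      rw [this]
      ring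
    · intro a ha b hb c hc
      have := hTM a ha
      simp only [List.mem_cons, List.not_mem_nil, or_false] at hc
      omega
    · intro a ha
      have := hTM a ha
      refine invAbove_eq_zero fun c hc => ?_
      simp only [List.mem_cons, List.not_mem_nil, or_false] at hc
      omega
  · ext a; simp only [Finset.mem_insert, Finset.mem_union, List.mem_toFinset, List.mem_cons,
      List.not_mem_nil, or_false]; tauto
  · exact hT
  · simp [Alt]; omega
  · simp; omega
  · intro a ha b hb
    have := hTM a ha
    simp only [List.mem_cons, List.not_mem_nil, or_false] at hb
    omega
  · intro σ hσ hne
    refine Finset.sum_eq_zero fun τ hτ => pow_eq_zero_of_le (m := 4) ?_ hq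
    by_contra! hocc
    have hmem : ∀ a, a ∈ σ ↔ a = m ∨ a = v ∨ a = y ∨ a ∈ T := fun a => by
      rw [mem_iff_of_mem_altWords hσ]; simp
    have hv := (hmem v).2 (by simp)
    have hm := (hmem m).2 (by simp)
    have hy := (hmem y).2 (by simp)
    have hdisj : Disjoint (insert m (insert v (insert y T))) S₂ := by
      rw [Finset.disjoint_left]
      intro a ha ha'
      have := h a ha'
      simp only [Finset.mem_insert] at ha
      rcases ha with rfl | rfl | rfl | ha
      · omega
      · omega
      · omega
      · have := hTM a ha; omega
    have hodd : Odd (insert m (insert v (insert y T))).card := by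
      have hvy' : v ∉ insert y T := by simp [hvy.ne, hvT]
      have hm' : m ∉ insert v (insert y T) := by simp [hmT]; omega
      rw [Finset.card_insert_of_notMem hm', Finset.card_insert_of_notMem hvy',
        Finset.card_insert_of_notMem hyT]
      simpa [parity_simps] using hT
    have hlt : ∀ a ∈ insert m (insert v (insert y T)), a < N := by
      simp only [Finset.mem_insert]
      rintro a (rfl | rfl | rfl | ha)
      · omega
      · omega
      · omega
      · exact h1 a ha
    rcases split_cases_of_mem hdisj hodd hlt h2 hσ hτ (by omega) with H' | H' | H'
    · have := H' m (by simp) M hM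
      omega
    · obtain ⟨s, z, rfl, h3, h4, -⟩ := H'
      rw [List.mem_append, List.mem_singleton] at hv hm
      have : v ∉ s := fun hv => by have := h4 v hv M hM; omega
      have : m ∉ s := fun hv => by have := h4 m hv M hM; omega
      have := hv.resolve_left ‹_›
      have := hm.resolve_left ‹_›
      omega
    · obtain ⟨s, v', y', m', M', rfl, h3, h4, h5, h6, h7, h8⟩ := H'
      have hMM := h7 M hM
      have hMM' := h M' h3
      have hM' : M' = M := by omega
      subst hM'
      simp only [List.mem_append, List.mem_cons, List.not_mem_nil, or_false] at hv hm hy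
      have hv := hv.resolve_left fun hv => by have := h8 v hv; omega
      have hm := hm.resolve_left fun hm => by have := h8 m hm; omega
      have hy := hy.resolve_left fun hy => by have := h8 y hy; omega
      obtain ⟨rfl, rfl, rfl⟩ : v' = v ∧ m' = m ∧ y' = y := by omega
      exact hne s rfl

end AltPerm

/-! ### Weights of the words after the maximum when one, two or three of their letters exceed `p`.
-/

namespace AltPerm

theorem exists_sublist_of_invAbove_ne_zero {p : ℕ} {l : List ℕ} (h : invAbove p l ≠ 0) :
    ∃ b c, [b, c].Sublist l ∧ p < c ∧ c < b := by
  induction l with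
  | nil => simp [invAbove] at h
  | cons a l ih =>
    by_cases h0 : invAbove p l = 0
    · rw [invAbove, h0, add_zero, Ne, List.countP_eq_zero] at h
      push Not at h
      obtain ⟨c, hc, h⟩ := h
      simp only [decide_eq_true_eq] at h
      exact ⟨a, c, (List.singleton_sublist.2 hc).cons_cons a, h⟩
    · obtain ⟨b, c, h1, h2⟩ := ih h0
      exact ⟨b, c, h1.cons a, h2⟩

theorem one_le_invAbove {p b c : ℕ} {l : List ℕ} (h : [b, c].Sublist l) (h1 : p < c) (h2 : c < b) :
    1 ≤ invAbove p l := by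
  refine le_trans ?_ (invAbove_le_of_sublist h)
  simp [invAbove, h1, h2]

theorem exists_cons_cons_of_mem_altWords {S : Finset ℕ} {l : List ℕ} (h : l ∈ altWords S)
    (hS : 2 ≤ S.card) : ∃ a b t, l = a :: b :: t ∧ a < b := by
  rw [← length_of_mem_altWords h] at hS
  match l, hS with
  | a :: b :: t, _ => exact ⟨a, b, t, rfl, (mem_altWords.1 h).2.2.1⟩

open Classical in
/-- Words that start with `x` followed by the largest letter `M`. -/
theorem sum_altWords_prefix {R : Type*} [AddCommMonoid R] {B : Finset ℕ} {x M : ℕ} (hx : x ∉ B)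
    (hxM : x < M) (hB : ∀ b ∈ B, b < M) (φ : List ℕ → R) :
    ∑ τ ∈ altWords (insert x (insert M B)), (if ∃ β, τ = x :: M :: β then φ τ else 0) =
      ∑ β ∈ altWords B, φ (x :: M :: β) := by
  symm
  refine Finset.sum_of_injOn (x :: M :: ·) (fun a _ b _ h => by simpa using h) ?_ ?_ ?_
  · intro β hβ
    obtain ⟨h1, rfl, h3⟩ := mem_altWords.1 hβ
    simp only [List.mem_toFinset] at hx hB
    refine mem_altWords.2 ⟨?_, by simp, hxM, ?_, h3⟩
    · simp only [List.nodup_cons, List.mem_cons, not_or]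
      exact ⟨⟨hxM.ne, hx⟩, fun h => (hB M h).false, h1⟩
    · exact fun c hc => hB c (List.mem_of_mem_head? hc)
  · intro τ hτ h
    rw [if_neg]
    rintro ⟨β, rfl⟩
    refine h ⟨β, ?_, rfl⟩
    obtain ⟨h1, h2, h3⟩ := mem_altWords.1 hτ
    refine mem_altWords.2 ⟨?_, ?_, h3.2.2⟩
    · exact (List.nodup_cons.1 (List.nodup_cons.1 h1).2).2
    · simp only [List.nodup_cons, List.mem_cons, not_or] at h1
      ext a
      have := Finset.ext_iff.1 h2 a
      simp only [List.toFinset_cons, Finset.mem_insert, List.mem_toFinset] at this ⊢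
      have : a ∈ B → a ≠ M := fun h => (hB a h).ne
      have : a ∈ B → a ≠ x := by rintro h' rfl; exact hx h'
      have : a ∈ β → a ≠ M := by rintro h' rfl; exact h1.2.1 h'
      have : a ∈ β → a ≠ x := by rintro h' rfl; exact h1.1.2 h'
      tauto
  · intro β _
    rw [if_pos ⟨β, rfl⟩]

variable {R : Type*} [CommRing R] {q : R}

theorem wt_eq_of_card (q : R) {S : Finset ℕ} {n : ℕ} (h : S.card = n) :
    wt q S = wt q (Finset.range n) := by rw [wt_eq, h]

theorem card_range_erase {n p : ℕ} (h : p < n + 1) : ((Finset.range (n + 1)).erase p).card = n := by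
  rw [Finset.card_erase_of_mem (by simpa using h)]; simp

theorem card_range_erase_erase_erase {n a b c : ℕ} (ha : a < n + 3) (hb : b < n + 3) (hc : c < n + 3)
    (hab : a ≠ b) (hac : a ≠ c) (hbc : b ≠ c) :
    ((((Finset.range (n + 3)).erase a).erase b).erase c).card = n := by
  rw [Finset.card_erase_of_mem, Finset.card_erase_of_mem, Finset.card_erase_of_mem]
  · simp
  · simpa using ha
  · simpa [hab.symm] using hb
  · simpa [hac.symm, hbc.symm] using hc

/-- A single letter above `i` cannot form a descent above `i`. -/
theorem sum_pow_invAbove_one (i : ℕ) :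
    ∑ τ ∈ altWords ((Finset.range (i + 2)).erase i), q ^ (1 + invAbove i τ + occL τ) =
      q * wt q (Finset.range (i + 1)) := by
  rw [← wt_eq_of_card q (card_range_erase (n := i + 1) (p := i) (by omega)), wt, Finset.mul_sum]
  refine Finset.sum_congr rfl fun τ hτ => ?_
  rw [invAbove_eq_zero_of_unique (M := i + 1), add_zero, pow_add, pow_one]
  intro c hc
  rw [mem_iff_of_mem_altWords hτ, Finset.mem_erase, Finset.mem_range] at hc
  omega

theorem sum_pow_invAbove_two_of_card :
    ∑ τ ∈ altWords ((Finset.range 3).erase 0), q ^ (2 + invAbove 0 τ + occL τ) =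
      q ^ 2 * wt q (Finset.range 2) := by
  rw [← wt_eq_of_card q (card_range_erase (n := 2) (p := 0) (by omega)), wt, Finset.mul_sum]
  refine Finset.sum_congr rfl fun τ hτ => ?_
  obtain ⟨a, b, t, rfl, hab⟩ := exists_cons_cons_of_mem_altWords hτ (by
    rw [card_range_erase (by omega)])
  have hl := length_of_mem_altWords hτ
  rw [card_range_erase (by omega)] at hl
  obtain rfl : t = [] := by simpa using hl
  have : invAbove 0 [a, b] = 0 := by
    simp [invAbove]; omega
  rw [this, add_zero, pow_add]

/-- The term `invAbove` matters only if `i + 3` precedes `i + 2`. All such words have at least two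
occurrences, and vanish with or without that term, except those starting with `i, i + 3`. These
vanish only with it, which accounts for the subtracted correction. -/
theorem sum_pow_invAbove_two (hq : q ^ 4 = 0) (i : ℕ) :
    ∑ τ ∈ altWords ((Finset.range (i + 4)).erase (i + 1)), q ^ (2 + invAbove (i + 1) τ + occL τ) =
      q ^ 2 * wt q (Finset.range (i + 3)) - q ^ 3 * wt q (Finset.range (i + 1)) := by
  classical
  have hS : insert i (insert (i + 3) ((((Finset.range (i + 4)).erase (i + 1)).erase i).erase
      (i + 3))) = (Finset.range (i + 4)).erase (i + 1) := by
    ext a; simp only [Finset.mem_insert, Finset.mem_erase, Finset.mem_range]; omega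
  have key := sum_altWords_prefix (B := (((Finset.range (i + 4)).erase (i + 1)).erase i).erase
      (i + 3)) (x := i) (M := i + 3) (by simp) (by omega) (by simp; omega)
      (fun τ => q ^ (2 + occL τ))
  rw [← wt_eq_of_card q (card_range_erase (n := i + 3) (p := i + 1) (by omega)),
    ← wt_eq_of_card q (card_range_erase_erase_erase (n := i + 1) (a := i + 1) (b := i) (c := i + 3)
      (by omega) (by omega) (by omega) (by omega) (by omega) (by omega)), wt, wt, Finset.mul_sum,
    Finset.mul_sum]
  rw [hS] at key
  have h2 : ∑ β ∈ altWords ((((Finset.range (i + 4)).erase (i + 1)).erase i).erase (i + 3)),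
      q ^ (2 + occL (i :: (i + 3) :: β)) =
      ∑ β ∈ altWords ((((Finset.range (i + 4)).erase (i + 1)).erase i).erase (i + 3)),
        q ^ 3 * q ^ occL β := by
    refine Finset.sum_congr rfl fun β hβ => ?_
    have hβ' : ∀ a, a ∈ β ↔ a = i + 2 ∨ a < i := fun a => by
      rw [mem_iff_of_mem_altWords hβ]
      simp only [Finset.mem_erase, Finset.mem_range]; omega
    have hn := (mem_altWords.1 hβ).1
    rw [occL, occL_max_cons (fun b hb => by have := (hβ' b).1 hb; omega), invAbove,
      invAbove_eq_zero_of_unique (M := i + 2) (fun c hc => by have := (hβ' c).1 hc; omega)]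
    have : β.countP (fun c => i < c ∧ c < i + 3) = 1 := by
      rw [← List.count_eq_one_of_mem hn ((hβ' (i + 2)).2 (.inl rfl)), List.count]
      refine List.countP_congr fun c hc => ?_
      have := (hβ' c).1 hc
      simp only [decide_eq_true_eq, beq_iff_eq]
      omega
    rw [this, ← pow_add]
    congr 1; omega
  rw [← h2, ← key, ← Finset.sum_sub_distrib]
  refine Finset.sum_congr rfl fun τ hτ => ?_
  have hmem : ∀ a, a ∈ τ ↔ a < i + 4 ∧ a ≠ i + 1 := fun a => by
    rw [mem_iff_of_mem_altWords hτ]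
    simp only [Finset.mem_erase, Finset.mem_range]; omega
  have hn := (mem_altWords.1 hτ).1
  split_ifs with hform
  · obtain ⟨β, rfl⟩ := hform
    have : i + 2 ∈ β := by simpa using (hmem (i + 2)).2 (by omega)
    have hinv : 1 ≤ invAbove (i + 1) (i :: (i + 3) :: β) :=
      one_le_invAbove (b := i + 3) (c := i + 2)
        (((List.singleton_sublist.2 this).cons_cons _).cons _) (by omega) (by omega)
    have hocc : 1 ≤ occL (i :: (i + 3) :: β) := by
      refine (le_of_eq ?_).trans (occL_le_of_sublist
        (((List.singleton_sublist.2 this).cons_cons (i + 3)).cons_cons i))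
      simp [occL, invAbove]
    rw [pow_eq_zero_of_le (by omega) hq, pow_add, sub_self]
  · rw [sub_zero, ← pow_add]
    by_cases hinv : invAbove (i + 1) τ = 0
    · rw [hinv, add_zero]
    -- The initial rise `a₀ < a₁` supplies two occurrences: `a₀` and `a₁` each with `i + 3, i + 2`,
    -- or, if `a₁ = i + 3`, the letter `a₀` with `i + 3` followed by `i` and by `i + 2`.
    have hocc : 2 ≤ occL τ := by
      obtain ⟨b, c, hbc, h3, h4⟩ := exists_sublist_of_invAbove_ne_zero hinv
      have hb := (hmem b).1 (hbc.subset (by simp))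
      obtain rfl : b = i + 3 := by omega
      obtain rfl : c = i + 2 := by omega
      obtain ⟨a₀, a₁, t, rfl, h01⟩ := exists_cons_cons_of_mem_altWords hτ
        (by
    rw [card_range_erase (by omega)]; omega)
      have ha0 := (hmem a₀).1 (by simp)
      have ha1 := (hmem a₁).1 (by simp)
      rw [List.nodup_cons, List.nodup_cons] at hn
      have hbc' : [i + 3, i + 2].Sublist (a₁ :: t) := by
        rcases List.sublist_cons_iff.1 hbc with h | ⟨r, h, -⟩
        · exact h
        · simp only [List.cons.injEq] at h; omega
      have ha0' : a₀ ≠ i + 2 := by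
        rintro rfl
        exact hn.1 (hbc'.subset (by simp))
      rcases eq_or_ne a₁ (i + 3) with rfl | h1
      · have hi : a₀ ≠ i := by rintro rfl; exact hform ⟨t, rfl⟩
        have h5 : i ∈ t := by
          have := (hmem i).2 (by omega)
          simpa [hi.symm] using this
        have h6 : i + 2 ∈ t := by
          have := (hmem (i + 2)).2 (by omega)
          simpa [ha0'.symm] using this
        rcases pair_sublist_or h5 h6 (by omega) with h | h
        · exact (by decide : 2 ≤ occL [0, 3, 1, 2]).trans (le_occL_of_sublist
            [a₀, i, i + 2, i + 3] [0, 3, 1, 2] (by simp; omega) (by simp)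
            ((h.cons_cons (i + 3)).cons_cons a₀))
        · exact (by decide : 2 ≤ occL [0, 3, 2, 1]).trans (le_occL_of_sublist
            [a₀, i, i + 2, i + 3] [0, 3, 2, 1] (by simp; omega) (by simp)
            ((h.cons_cons (i + 3)).cons_cons a₀))
      · have hbc'' : [i + 3, i + 2].Sublist t := by
          rcases List.sublist_cons_iff.1 hbc' with h | ⟨r, h, -⟩
          · exact h
          · simp only [List.cons.injEq] at h; omega
        have ha1' : a₁ ≠ i + 2 := by
          rintro rfl
          exact hn.2.1 (hbc''.subset (by simp))
        exact (by decide : 2 ≤ occL [0, 1, 3, 2]).trans (le_occL_of_sublist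
            [a₀, a₁, i + 2, i + 3] [0, 1, 3, 2] (by simp; omega) (by simp)
            ((hbc''.cons_cons a₁).cons_cons a₀))
    rw [pow_eq_zero_of_le (by omega) hq, pow_eq_zero_of_le (by omega) hq]

/-- The factor `q ^ 3` leaves only words without occurrences. Among these, a descent above `i`
exists only if the word starts with `i + 2, i + 3`; those words are subtracted. -/
theorem sum_pow_invAbove_three (hq : q ^ 4 = 0) (i : ℕ) :
    ∑ τ ∈ altWords ((Finset.range (i + 4)).erase i), q ^ (3 + invAbove i τ + occL τ) =
      q ^ 3 * (wt q (Finset.range (i + 3)) - wt q (Finset.range (i + 1))) := by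
  classical
  have hS : insert (i + 2) (insert (i + 3) ((((Finset.range (i + 4)).erase i).erase (i + 2)).erase
      (i + 3))) = (Finset.range (i + 4)).erase i := by
    ext a; simp only [Finset.mem_insert, Finset.mem_erase, Finset.mem_range]; omega
  have key := sum_altWords_prefix (B := (((Finset.range (i + 4)).erase i).erase (i + 2)).erase
      (i + 3)) (x := i + 2) (M := i + 3) (by simp) (by omega) (by simp; omega)
      (fun τ => q ^ (3 + occL τ))
  rw [← wt_eq_of_card q (card_range_erase (n := i + 3) (p := i) (by omega)),
    ← wt_eq_of_card q (card_range_erase_erase_erase (n := i + 1) (a := i) (b := i + 2) (c := i + 3)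
      (by omega) (by omega) (by omega) (by omega) (by omega) (by omega)), mul_sub, wt, wt,
    Finset.mul_sum, Finset.mul_sum]
  rw [hS] at key
  have h2 : ∑ β ∈ altWords ((((Finset.range (i + 4)).erase i).erase (i + 2)).erase (i + 3)),
      q ^ (3 + occL ((i + 2) :: (i + 3) :: β)) =
      ∑ β ∈ altWords ((((Finset.range (i + 4)).erase i).erase (i + 2)).erase (i + 3)),
        q ^ 3 * q ^ occL β := by
    refine Finset.sum_congr rfl fun β hβ => ?_
    have hβ' : ∀ a ∈ β, a < i + 2 := fun a => by
      rw [mem_iff_of_mem_altWords hβ]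
      simp only [Finset.mem_erase, Finset.mem_range]; omega
    rw [occL, occL_max_cons (fun b hb => by have := hβ' b hb; omega),
      invAbove_cons_eq_zero (fun c hc => (hβ' c hc).le), zero_add, pow_add]
  rw [← h2, ← key, ← Finset.sum_sub_distrib]
  refine Finset.sum_congr rfl fun τ hτ => ?_
  have hmem : ∀ a, a ∈ τ ↔ a < i + 4 ∧ a ≠ i := fun a => by
    rw [mem_iff_of_mem_altWords hτ]
    simp only [Finset.mem_erase, Finset.mem_range]; omega
  have hn := (mem_altWords.1 hτ).1
  split_ifs with hform
  · obtain ⟨β, rfl⟩ := hform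
    have : i + 1 ∈ β := by simpa using (hmem (i + 1)).2 (by omega)
    have hinv : 1 ≤ invAbove i ((i + 2) :: (i + 3) :: β) :=
      one_le_invAbove (b := i + 3) (c := i + 1)
        (((List.singleton_sublist.2 this).cons_cons _).cons _) (by omega) (by omega)
    rw [pow_eq_zero_of_le (by omega) hq, pow_add, sub_self]
  · rw [sub_zero, ← pow_add]
    by_cases hinv : invAbove i τ = 0
    · rw [hinv, add_zero]
    -- A descent `b … c` above `i` that avoids the first letter forms 1-3-2 with it, as the
    -- alternative `a₀ > c` would force the excluded beginning `i + 2, i + 3`.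
    have hocc : 1 ≤ occL τ := by
      obtain ⟨b, c, hbc, h3, h4⟩ := exists_sublist_of_invAbove_ne_zero hinv
      have hb := (hmem b).1 (hbc.subset (by simp))
      obtain ⟨a₀, a₁, t, rfl, h01⟩ := exists_cons_cons_of_mem_altWords hτ
        (by
    rw [card_range_erase (by omega)]; omega)
      have ha0 := (hmem a₀).1 (by simp)
      have ha1 := (hmem a₁).1 (by simp)
      rw [List.nodup_cons] at hn
      have hne : ¬ (a₀ = i + 2 ∧ a₁ = i + 3) := by
        rintro ⟨rfl, rfl⟩; exact hform ⟨t, rfl⟩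
      rcases List.sublist_cons_iff.1 hbc with h | ⟨r, h, -⟩
      · have ha0c : a₀ ≠ c := by
          rintro rfl
          exact hn.1 (h.subset (by simp))
        exact (by decide : 1 ≤ occL [0, 2, 1]).trans (le_occL_of_sublist
            [a₀, c, b] [0, 2, 1] (by simp; omega) (by simp) (h.cons_cons a₀))
      · simp only [List.cons.injEq] at h; omega
    rw [pow_eq_zero_of_le (by omega) hq, pow_eq_zero_of_le (by omega) hq]

end AltPerm

/-! ### The possible sets of letters before the maximum. -/

namespace AltPerm

theorem eq_range_of_forall_lt {N : ℕ} {A : Finset ℕ} (hA : ∀ a ∈ A, a < N)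
    (h : ∀ a ∈ A, ∀ b < N, b ∉ A → a < b) : A = Finset.range A.card := by
  refine Finset.eq_of_subset_of_card_le (fun a ha => ?_) (by simp)
  rw [Finset.mem_range, ← Nat.succ_le_iff, ← Finset.card_range a.succ]
  refine Finset.card_le_card fun b hb => ?_
  rw [Finset.mem_range] at hb
  by_contra hbA
  have := hA a ha
  have := h a ha b (by omega) hbA
  omega

variable {R : Type*} [CommRing R] {q : R}

/-- The sets of letters before the largest letter in a word with at most three occurrences
of 1-3-2. -/
theorem exists_eq_of_splitWt_ne_zero (hq : q ^ 4 = 0) {k j : ℕ} (hk : Odd k) {S : Finset ℕ}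
    (hS : S ∈ (Finset.range (k + j)).powersetCard k)
    (h0 : splitWt q S (Finset.range (k + j) \ S) (k + j) ≠ 0) :
    (∃ p ≤ j, S = insert p (Finset.Ico (j + 1) (k + j))) ∨
    ∃ i, j = i + 1 ∧ 3 ≤ k ∧ (S = insert i (insert (i + 1) (Finset.Ico (i + 3) (k + j))) ∨
      S = insert i (insert (i + 1) (insert (i + 2) (Finset.Ico (i + 4) (k + j))))) := by
  obtain ⟨hSN, hcard⟩ := Finset.mem_powersetCard.1 hS
  have hlt : ∀ a ∈ S, a < k + j := fun a ha => Finset.mem_range.1 (hSN ha)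
  obtain ⟨σ, hσ, h0⟩ := Finset.exists_ne_zero_of_sum_ne_zero h0
  obtain ⟨τ, hτ, h0⟩ := Finset.exists_ne_zero_of_sum_ne_zero h0
  have hocc : occL (σ ++ (k + j) :: τ) ≤ 3 := by
    by_contra! h
    exact h0 (pow_eq_zero_of_le h hq)
  set S₂ := Finset.range (k + j) \ S with hS₂
  have hS₂card : S₂.card = j := by
    rw [hS₂, Finset.card_sdiff_of_subset hSN, hcard, Finset.card_range]; omega
  have hmem₂ : ∀ a, a ∈ S₂ ↔ a < k + j ∧ a ∉ S := fun a => by simp [hS₂]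
  have hcase := split_cases_of_mem Finset.disjoint_sdiff (by rwa [hcard]) hlt
    (fun a ha => ((hmem₂ a).1 ha).1) hσ hτ hocc
  have hk1 : 1 ≤ k := hk.pos
  rcases hcase with h | ⟨s, m, rfl, h1, h2, b, hb, hmb⟩ |
    ⟨s, v, y, m, M, rfl, hM, hmv, hvM, hvy, h1, h2⟩
  -- The first shape is the case `p = j`: the letters after `N` are exactly the `j` smallest.
  · have hr := eq_range_of_forall_lt (N := k + j) (A := S₂) (fun a ha => ((hmem₂ a).1 ha).1)
      (fun a ha b hb hbS => h b (by_contra fun hbS' => hbS ((hmem₂ b).2 ⟨hb, hbS'⟩)) a ha)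
    rw [hS₂card] at hr
    refine .inl ⟨j, le_rfl, ?_⟩
    ext a
    have h3 := hmem₂ a
    rw [hr, Finset.mem_range] at h3
    have h4 := hlt a
    rw [Finset.mem_insert, Finset.mem_Ico]
    by_cases ha : a ∈ S <;> 
      simp only [ha, true_iff, false_iff, true_implies, not_true, and_false, iff_false,
        not_false_iff, and_true] at h3 h4 ⊢ <;> omega
  · have hmemS : ∀ a, a ∈ S ↔ a ∈ s ∨ a = m := fun a => by
      rw [← mem_iff_of_mem_altWords hσ]; simp
    have hmS := (hmemS m).2 (.inr rfl)
    have hm2 : m ∉ S₂ := fun h => ((hmem₂ m).1 h).2 hmS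
    -- In the second shape `m` and the letters after `N` are together the `j + 1` smallest.
    have hr := eq_range_of_forall_lt (N := k + j) (A := insert m S₂) (by
        simp only [Finset.mem_insert]
        rintro a (rfl | ha)
        · exact hlt _ hmS
        · exact ((hmem₂ a).1 ha).1) (by
        intro a ha b hb hbS
        simp only [Finset.mem_insert, not_or, hmem₂, not_and, not_not] at ha hbS
        have hbs := ((hmemS b).1 (hbS.2 hb)).resolve_right hbS.1
        rcases ha with rfl | ha
        · exact h1 b hbs
        · exact h2 b hbs a ((hmem₂ a).2 ha))
    rw [Finset.card_insert_of_notMem hm2, hS₂card] at hr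
    have hmj : m < j + 1 := by
      rw [← Finset.mem_range, ← hr]; simp
    refine .inl ⟨m, by omega, ?_⟩
    ext a
    have h3 := Finset.ext_iff.1 hr a
    rw [Finset.mem_range, Finset.mem_insert, hmem₂] at h3
    have h4 := hlt a
    rw [Finset.mem_insert, Finset.mem_Ico]
    have h5 : a = m → a ∈ S := by rintro rfl; exact hmS
    by_cases ha : a ∈ S <;>
      simp only [ha, true_implies, not_true, and_false, or_false, not_false_iff, and_true,
        true_iff, false_iff, imp_false] at h3 h4 h5 ⊢ <;> omega
  · have hmemS : ∀ a, a ∈ S ↔ a ∈ s ∨ a = v ∨ a = y ∨ a = m := fun a => by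
      rw [← mem_iff_of_mem_altWords hσ]; simp
    have hk3 : 3 ≤ k := by
      rw [← hcard, ← length_of_mem_altWords hσ]; simp
    have hmS := (hmemS m).2 (by simp)
    have hvS := (hmemS v).2 (by simp)
    have hyS := (hmemS y).2 (by simp)
    have hmN := hlt m hmS
    have hvN := hlt v hvS
    have hyN := hlt y hyS
    have hMN := ((hmem₂ M).1 hM).1
    have hyM : y ≠ M := by rintro rfl; exact ((hmem₂ _).1 hM).2 hyS
    have hr := eq_range_of_forall_lt (N := k + j) (A := S₂.erase M) (by
        intro a ha
        exact ((hmem₂ a).1 (Finset.mem_of_mem_erase ha)).1) (by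
        intro a ha b hb hbS
        have ham := (h1 a (Finset.mem_of_mem_erase ha)).resolve_left (Finset.ne_of_mem_erase ha)
        by_cases hbM : b = M
        · omega
        · have hbS' : b ∈ S := by
            by_contra hbS'
            exact hbS (Finset.mem_erase.2 ⟨hbM, (hmem₂ b).2 ⟨hb, hbS'⟩⟩)
          rcases (hmemS b).1 hbS' with hb | rfl | rfl | rfl
          · have := h2 b hb; omega
          all_goals omega)
    obtain ⟨i, rfl⟩ : ∃ i, j = i + 1 := by
      have : 0 < S₂.card := Finset.card_pos.2 ⟨M, hM⟩
      exact ⟨j - 1, by omega⟩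
    rw [Finset.card_erase_of_mem hM, hS₂card, Nat.add_sub_cancel] at hr
    have hlow : ∀ a, a < i ↔ a ≠ M ∧ a < k + (i + 1) ∧ a ∉ S := fun a => by
      rw [← hmem₂, ← Finset.mem_range, ← hr, Finset.mem_erase]
    have hrest : ∀ a, a < k + (i + 1) → a < i ∨ a = M ∨ a = m ∨ a = v ∨ a = y ∨ M < a := by
      intro a ha
      by_cases haS : a ∈ S
      · rcases (hmemS a).1 haS with hb | hb | hb | hb
        · have := h2 a hb; omega
        all_goals omega
      · by_cases haM : a = M
        · omega
        · exact .inl ((hlow a).2 ⟨haM, ha, haS⟩)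
    -- The letters below `i` are those after `N` other than `M`. Above them come `m = i` and `v = i
    -- + 1`, then `M`, possibly with `y` in between.
    have hm1 : ¬ m < i := fun h => ((hlow m).1 h).2.2 hmS
    have hv1 : ¬ v < i := fun h => ((hlow v).1 h).2.2 hvS
    have hy1 : ¬ y < i := fun h => ((hlow y).1 h).2.2 hyS
    have hM1 : ¬ M < i := fun h => ((hlow M).1 h).1 rfl
    have hm : m = i := by have := hrest i (by omega); omega
    have hv : v = i + 1 := by have := hrest (i + 1) (by omega); omega
    refine .inr ⟨i, rfl, hk3, ?_⟩
    have hMS : M ∉ S := ((hmem₂ M).1 hM).2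
    rcases lt_or_gt_of_ne hyM with h | h
    · have hy : y = i + 2 := by have := hrest (i + 2) (by omega); omega
      have hM' : M = i + 3 := by have := hrest (i + 3) (by omega); omega
      right
      ext a
      have h3 := hlow a
      have h4 := hlt a
      have h5 : a = m → a ∈ S := by rintro rfl; exact hmS
      have h6 : a = v → a ∈ S := by rintro rfl; exact hvS
      have h7 : a = y → a ∈ S := by rintro rfl; exact hyS
      have h8 : a = M → a ∉ S := by rintro rfl; exact hMS
      simp only [Finset.mem_insert, Finset.mem_Ico]
      by_cases ha : a ∈ S <;>
        simp only [ha, true_implies, not_true, and_false, not_false_iff, and_true, implies_true,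
          true_iff, false_iff, imp_false, iff_false] at h3 h4 h5 h6 h7 h8 ⊢ <;> omega
    · have hM' : M = i + 2 := by have := hrest (i + 2) (by omega); omega
      left
      ext a
      have h3 := hlow a
      have h4 := hlt a
      have h5 : a = m → a ∈ S := by rintro rfl; exact hmS
      have h6 : a = v → a ∈ S := by rintro rfl; exact hvS
      have h8 : a = M → a ∉ S := by rintro rfl; exact hMS
      simp only [Finset.mem_insert, Finset.mem_Ico]
      by_cases ha : a ∈ S <;>
        simp only [ha, true_implies, not_true, and_false, not_false_iff, and_true, implies_true,
          true_iff, false_iff, imp_false, iff_false] at h3 h4 h5 h6 h8 ⊢ <;> omega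

end AltPerm

/-! ### Total weight for given numbers of letters before and after the maximum. -/

namespace AltPerm

variable {R : Type*} [CommRing R] {q : R}

/-- The generating polynomial of the alternating words of length `n`. -/
noncomputable def altWt (q : R) (n : ℕ) : R := wt q (Finset.range n)

/-- The generating polynomial of the alternating words of length `n` that end with the
second smallest letter, a letter, and the smallest one. -/
noncomputable def endWt (q : R) (n : ℕ) : R := valleyWt q (Finset.range n) 1 0

theorem splitWt_block (k j : ℕ) (hk : 1 ≤ k) :
    splitWt q (insert j (Finset.Ico (j + 1) (k + j)))
      (Finset.range (k + j) \ insert j (Finset.Ico (j + 1) (k + j))) (k + j) =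
      altWt q k * altWt q j := by
  have h1 : insert j (Finset.Ico (j + 1) (k + j)) = Finset.Ico j (k + j) := by
    ext; simp; omega
  have h2 : Finset.range (k + j) \ insert j (Finset.Ico (j + 1) (k + j)) = Finset.range j := by
    ext; simp; omega
  rw [h1] at h2 ⊢
  rw [h2, splitWt_of_gt, wt_eq_of_card q (n := k) (by simp)]
  · rfl
  · simp only [Finset.mem_Ico, Finset.mem_range]; omega
  · simp
  · simp only [Finset.mem_range]; omega

theorem splitWt_min_block (hq : q ^ 4 = 0) {k j p : ℕ} (hk : Odd k) (hp : p < j) :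
    splitWt q (insert p (Finset.Ico (j + 1) (k + j)))
      (Finset.range (k + j) \ insert p (Finset.Ico (j + 1) (k + j))) (k + j) =
      altWt q (k - 1) * ∑ τ ∈ altWords ((Finset.range (j + 1)).erase p),
        q ^ (j - p + invAbove p τ + occL τ) := by
  have hk1 := hk.pos
  have h2 : Finset.range (k + j) \ insert p (Finset.Ico (j + 1) (k + j)) =
      (Finset.range (j + 1)).erase p := by
    ext; simp; omega
  have hc : (((Finset.range (j + 1)).erase p).filter (p < ·)).card = j - p := by
    have : ((Finset.range (j + 1)).erase p).filter (p < ·) = Finset.Ioc p j := by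
      ext; simp; omega
    rw [this, Nat.card_Ioc]
  have hcard : (Finset.Ico (j + 1) (k + j)).card = k - 1 := by rw [Nat.card_Ico]; omega
  rw [h2, splitWt_of_min hq, hc, wt_eq_of_card q hcard]
  · rfl
  · rw [hcard]; obtain ⟨c, rfl⟩ := hk; simp
  · simp only [Finset.mem_Ico]; omega
  · simp only [Finset.mem_Ico, Finset.mem_erase, Finset.mem_range]; omega
  · simp
  · exact ⟨j, by simp; omega, hp⟩
  · simp
  · simp only [Finset.mem_erase, Finset.mem_range]; omega

/-- The relabelling `f` skips the value `i + 2`, which is the letter `M` standing after the maximum.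
-/
theorem valleyWt_eq_endWt {k i : ℕ} (hk : 2 ≤ k) :
    valleyWt q (insert i (insert (i + 1) (Finset.Ico (i + 3) (k + (i + 1))))) (i + 1) i =
      endWt q k := by
  classical
  set f : ℕ → ℕ := fun a => if a < 2 then a + i else a + i + 1 with hf
  have hf' : StrictMono f := by
    intro a b hab; simp only [hf]; split_ifs <;> omega
  have hS : (Finset.range k).image f =
      insert i (insert (i + 1) (Finset.Ico (i + 3) (k + (i + 1)))) := by
    ext a
    simp only [Finset.mem_image, Finset.mem_range, Finset.mem_insert, Finset.mem_Ico, hf]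
    constructor
    · rintro ⟨b, hb, rfl⟩
      split_ifs <;> omega
    · intro ha
      by_cases h : a < i + 2
      · exact ⟨a - i, by omega, by split_ifs <;> omega⟩
      · exact ⟨a - i - 1, by omega, by split_ifs <;> omega⟩
  have h0 : f 0 = i := by simp [hf]
  have h1 : f 1 = i + 1 := by simp [hf]; omega
  rw [endWt, valleyWt, valleyWt, ← hS, sum_altWords_image (hf'.strictMonoOn _)]
  refine Finset.sum_congr rfl fun l hl => ?_
  rw [occL_map (hf'.strictMonoOn Set.univ) (by simp)]
  refine if_congr ⟨?_, ?_⟩ rfl rfl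
  · rintro ⟨s, y, h⟩
    obtain ⟨s', w, rfl, rfl, hw⟩ := List.map_eq_append_iff.1 h
    rcases w with - | ⟨a, - | ⟨b, - | ⟨c, - | ⟨d, w⟩⟩⟩⟩ <;> simp at hw
    obtain ⟨ha, rfl, hc⟩ := hw
    rw [← h1] at ha
    rw [← h0] at hc
    rw [hf'.injective ha, hf'.injective hc]
    exact ⟨s', b, rfl⟩
  · rintro ⟨s, y, rfl⟩
    exact ⟨s.map f, f y, by simp [h0, h1]⟩

theorem splitWt_two_block (hq : q ^ 4 = 0) {k i : ℕ} (hk : Odd k) (hk3 : 3 ≤ k) :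
    splitWt q (insert i (insert (i + 1) (Finset.Ico (i + 3) (k + (i + 1)))))
      (Finset.range (k + (i + 1)) \ insert i (insert (i + 1) (Finset.Ico (i + 3) (k + (i + 1)))))
      (k + (i + 1)) = q ^ 3 * (endWt q k * altWt q (i + 1)) := by
  have h2 : Finset.range (k + (i + 1)) \
      insert i (insert (i + 1) (Finset.Ico (i + 3) (k + (i + 1)))) = insert (i + 2) (Finset.range i) := by
    ext; simp; omega
  rw [h2, splitWt_of_two hq (M := i + 2), valleyWt_eq_endWt (by omega),
    wt_eq_of_card q (n := i + 1) (by simp)]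
  · rfl
  · rw [Nat.card_Ico]; obtain ⟨c, rfl⟩ := hk; exact ⟨c - 1, by omega⟩
  · omega
  · omega
  · simp
  · simp
  · simp only [Finset.mem_Ico]; omega
  · simp
  · simp only [Finset.mem_insert, Finset.mem_range]; omega

theorem splitWt_three_block (hq : q ^ 4 = 0) {k i : ℕ} (hk : Odd k) (hk3 : 3 ≤ k) :
    splitWt q (insert i (insert (i + 1) (insert (i + 2) (Finset.Ico (i + 4) (k + (i + 1))))))
      (Finset.range (k + (i + 1)) \
        insert i (insert (i + 1) (insert (i + 2) (Finset.Ico (i + 4) (k + (i + 1))))))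
      (k + (i + 1)) = q ^ 3 * (altWt q (k - 3) * altWt q (i + 1)) := by
  have h2 : Finset.range (k + (i + 1)) \
      insert i (insert (i + 1) (insert (i + 2) (Finset.Ico (i + 4) (k + (i + 1))))) =
        insert (i + 3) (Finset.range i) := by
    ext; simp; omega
  have hcard : (Finset.Ico (i + 4) (k + (i + 1))).card = k - 3 := by rw [Nat.card_Ico]; omega
  have hcard' : (insert (i + 3) (Finset.range i)).card = i + 1 := by simp
  rw [h2, splitWt_of_three hq (M := i + 3), wt_eq_of_card q hcard, wt_eq_of_card q hcard']
  · rfl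
  · rw [hcard]; obtain ⟨c, rfl⟩ := hk; exact ⟨c - 1, by omega⟩
  · omega
  · omega
  · omega
  · simp
  · simp
  · simp only [Finset.mem_Ico]; omega
  · simp
  · simp only [Finset.mem_insert, Finset.mem_range]; omega

/-- The contribution of the letters after the largest letter `N` in a word that has occurrences
`m-N-b` of 1-3-2 only for `m` the last letter before `N`. -/
noncomputable def tailWt (q : R) : ℕ → R
  | 0 => 0
  | 1 => q * altWt q 1
  | 2 => q * altWt q 2 + q ^ 2 * altWt q 2
  | i + 3 => q * altWt q (i + 3) + (q ^ 2 * altWt q (i + 3) - q ^ 3 * altWt q (i + 1)) +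
      q ^ 3 * (altWt q (i + 3) - altWt q (i + 1))

theorem sum_splitWt_min_block (hq : q ^ 4 = 0) {k : ℕ} (j : ℕ) (hk : Odd k) :
    ∑ p ∈ Finset.range j, splitWt q (insert p (Finset.Ico (j + 1) (k + j)))
      (Finset.range (k + j) \ insert p (Finset.Ico (j + 1) (k + j))) (k + j) =
      altWt q (k - 1) * tailWt q j := by
  rw [Finset.sum_congr rfl fun p hp => splitWt_min_block hq hk (Finset.mem_range.1 hp),
    ← Finset.mul_sum]
  congr 1
  match j with
  | 0 => simp [tailWt]
  | 1 =>
    rw [Finset.sum_range_one, tailWt]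
    exact sum_pow_invAbove_one 0
  | 2 =>
    rw [Finset.sum_range_succ, Finset.sum_range_one, tailWt, add_comm]
    exact congrArg₂ _ (sum_pow_invAbove_one (q := q) 1) sum_pow_invAbove_two_of_card
  | i + 3 =>
    rw [Finset.sum_range_succ, Finset.sum_range_succ, Finset.sum_range_succ, tailWt,
      Finset.sum_eq_zero, zero_add]
    · have e1 : i + 3 - (i + 2) = 1 := by omega
      have e2 : i + 3 - (i + 1) = 2 := by omega
      have e3 : i + 3 - i = 3 := by omega
      rw [e1, e2, e3, sum_pow_invAbove_one, sum_pow_invAbove_two hq, sum_pow_invAbove_three hq]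
      simp only [altWt]
      ring
    -- For these `p` at least four letters after the maximum exceed `p`, so each term has a factor
    -- `q ^ 4`.
    · intro p hp
      rw [Finset.mem_range] at hp
      exact Finset.sum_eq_zero fun τ _ => pow_eq_zero_of_le (by omega) hq

theorem endWt_one : endWt q 1 = 0 := by
  classical
  rw [endWt, valleyWt]
  refine Finset.sum_eq_zero fun σ hσ => if_neg ?_
  rintro ⟨s, y, rfl⟩
  have := length_of_mem_altWords hσ
  simp at this

/-- All words with `k` letters before the largest letter and `j` after it. -/
theorem sum_splitWt (hq : q ^ 4 = 0) {k : ℕ} (j : ℕ) (hk : Odd k) :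
    ∑ S ∈ (Finset.range (k + j)).powersetCard k,
      splitWt q S (Finset.range (k + j) \ S) (k + j) =
      altWt q k * altWt q j + altWt q (k - 1) * tailWt q j +
        if 1 ≤ j then q ^ 3 * ((endWt q k + if 3 ≤ k then altWt q (k - 3) else 0) * altWt q j)
        else 0 := by
  have hk1 := hk.pos
  set F : Finset ℕ → R := fun S => splitWt q S (Finset.range (k + j) \ S) (k + j) with hF
  set P : ℕ → Finset ℕ := fun p => insert p (Finset.Ico (j + 1) (k + j)) with hP
  have hPinj : Set.InjOn P (Finset.range (j + 1)) := by
    intro a ha b hb hab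
    have h : a ∈ P b := by rw [← hab]; simp [hP]
    simp only [hP, Finset.mem_insert, Finset.mem_Ico] at h
    simp only [Finset.coe_range, Set.mem_Iio] at ha
    omega
  have hPsub : (Finset.range (j + 1)).image P ⊆ (Finset.range (k + j)).powersetCard k := by
    intro S hS
    obtain ⟨p, hp, rfl⟩ := Finset.mem_image.1 hS
    rw [Finset.mem_range] at hp
    rw [Finset.mem_powersetCard]
    constructor
    · intro a; simp only [hP, Finset.mem_insert, Finset.mem_Ico, Finset.mem_range]; omega
    · rw [Finset.card_insert_of_notMem (by simp; omega), Nat.card_Ico]; omega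
  have hsumP : ∑ S ∈ (Finset.range (j + 1)).image P, F S =
      altWt q k * altWt q j + altWt q (k - 1) * tailWt q j := by
    rw [Finset.sum_image hPinj, Finset.sum_range_succ, ← sum_splitWt_min_block hq j hk, add_comm]
    exact congrArg₂ _ (splitWt_block k j hk1) rfl
  by_cases hkj : 1 ≤ j ∧ 3 ≤ k
  · obtain ⟨i, rfl⟩ : ∃ i, j = i + 1 := ⟨j - 1, by omega⟩
    set C := insert i (insert (i + 1) (Finset.Ico (i + 3) (k + (i + 1)))) with hC
    set D := insert i (insert (i + 1) (insert (i + 2) (Finset.Ico (i + 4) (k + (i + 1))))) with hD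
    have hCD : C ≠ D := fun h => by
      have := Finset.ext_iff.1 h (i + 2)
      simp [hC, hD] at this
    have hsub : (Finset.range (i + 1 + 1)).image P ∪ {C, D} ⊆
        (Finset.range (k + (i + 1))).powersetCard k := by
      refine Finset.union_subset hPsub ?_
      intro S hS
      rw [Finset.mem_insert, Finset.mem_singleton] at hS
      rw [Finset.mem_powersetCard]
      rcases hS with rfl | rfl
      · constructor
        · intro a; simp only [hC, Finset.mem_insert, Finset.mem_Ico, Finset.mem_range]; omega
        · rw [Finset.card_insert_of_notMem (by simp), Finset.card_insert_of_notMem (by simp),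
            Nat.card_Ico]; omega
      · constructor
        · intro a; simp only [hD, Finset.mem_insert, Finset.mem_Ico, Finset.mem_range]; omega
        · rw [Finset.card_insert_of_notMem (by simp), Finset.card_insert_of_notMem (by simp),
            Finset.card_insert_of_notMem (by simp), Nat.card_Ico]; omega
    rw [← Finset.sum_subset hsub, Finset.sum_union, hsumP, Finset.sum_pair hCD, if_pos hkj.1,
      if_pos hkj.2]
    · congr 1
      exact (congrArg₂ _ (splitWt_two_block hq hk hkj.2)
        (splitWt_three_block hq hk hkj.2)).trans (by ring)
    · rw [Finset.disjoint_left]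
      intro S hS hS'
      obtain ⟨p, hp, rfl⟩ := Finset.mem_image.1 hS
      have h : i ∈ P p ∧ i + 1 ∈ P p := by
        rw [Finset.mem_insert, Finset.mem_singleton] at hS'
        rcases hS' with h | h <;> rw [h] <;> simp [hC, hD]
      simp only [hP, Finset.mem_insert, Finset.mem_Ico] at h
      omega
    · intro S hS hS'
      by_contra h0
      rcases exists_eq_of_splitWt_ne_zero hq hk hS h0 with ⟨p, hp, rfl⟩ | ⟨i', hi, -, h⟩
      · exact hS' (Finset.mem_union_left _ (Finset.mem_image.2 ⟨p, by simp; omega, rfl⟩))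
      · obtain rfl : i' = i := by omega
        exact hS' (Finset.mem_union_right _ (by simpa [hC, hD] using h))
  -- For `j = 0` or `k = 1` the exceptional sets do not arise, and the corresponding terms of the
  -- formula are zero.
  · rw [← Finset.sum_subset hPsub, hsumP]
    · split_ifs with h1 h2
      · omega
      · obtain rfl : k = 1 := by obtain ⟨c, rfl⟩ := hk; omega
        simp [endWt_one]
      · simp
    · intro S hS hS'
      by_contra h0
      rcases exists_eq_of_splitWt_ne_zero hq hk hS h0 with ⟨p, hp, rfl⟩ | ⟨i', hi, h3, h⟩
      · exact hS' (Finset.mem_image.2 ⟨p, by simp; omega, rfl⟩)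
      · omega

end AltPerm

/-! ### Recurrences in the length. -/

namespace AltPerm

theorem sum_altWords_range_succ {R : Type*} [AddCommMonoid R] {N : ℕ} (hN : N ≠ 0)
    (φ : List ℕ → R) : ∑ l ∈ altWords (Finset.range (N + 1)), φ l =
      ∑ x ∈ Finset.HasAntidiagonal.antidiagonal N, if Odd x.1 then
        ∑ S ∈ (Finset.range (x.1 + x.2)).powersetCard x.1, ∑ σ ∈ altWords S,
          ∑ τ ∈ altWords (Finset.range (x.1 + x.2) \ S), φ (σ ++ (x.1 + x.2) :: τ) else 0 := by
  rw [Finset.range_add_one, sum_altWords_insert_max (by simp) (by simpa using hN),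
    Finset.sum_filter, Finset.sum_powerset, Finset.card_range,
    Finset.Nat.sum_antidiagonal_eq_sum_range_succ_mk]
  refine Finset.sum_congr rfl fun k hk => ?_
  have hkN : k + (N - k) = N := by rw [Finset.mem_range] at hk; omega
  simp only [hkN]
  split_ifs with h
  · refine Finset.sum_congr rfl fun S hS => ?_
    rw [if_pos (by rwa [(Finset.mem_powersetCard.1 hS).2])]
  · refine Finset.sum_eq_zero fun S hS => ?_
    rw [if_neg (by rwa [(Finset.mem_powersetCard.1 hS).2])]

variable {R : Type*} [CommRing R] {q : R}

theorem altWords_range_zero : altWords (Finset.range 0) = {[]} := by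
  ext l
  rw [mem_altWords, Finset.mem_singleton]
  constructor
  · rintro ⟨-, h, -⟩; simpa using h
  · rintro rfl; simp [Alt]

theorem altWt_zero : altWt q 0 = 1 := by
  rw [altWt, wt, altWords_range_zero, Finset.sum_singleton, occL, pow_zero]

theorem altWords_range_one : altWords (Finset.range 1) = {[0]} := by
  ext l
  rw [Finset.mem_singleton]
  constructor
  · intro h
    have hl := length_of_mem_altWords h
    rw [Finset.card_range, List.length_eq_one_iff] at hl
    obtain ⟨a, rfl⟩ := hl
    have := (mem_iff_of_mem_altWords h (a := a)).1 (by simp)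
    simpa using this
  · rintro rfl; rw [mem_altWords]; simp [Alt]

theorem altWt_one : altWt q 1 = 1 := by
  rw [altWt, wt, altWords_range_one, Finset.sum_singleton]; simp [occL, invAbove]

theorem altWt_succ (hq : q ^ 4 = 0) {N : ℕ} (hN : N ≠ 0) : altWt q (N + 1) =
    ∑ x ∈ Finset.HasAntidiagonal.antidiagonal N, if Odd x.1 then
      altWt q x.1 * altWt q x.2 + altWt q (x.1 - 1) * tailWt q x.2 +
        if 1 ≤ x.2 then
          q ^ 3 * ((endWt q x.1 + if 3 ≤ x.1 then altWt q (x.1 - 3) else 0) * altWt q x.2)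
        else 0
      else 0 := by
  rw [altWt, wt, sum_altWords_range_succ hN]
  refine Finset.sum_congr rfl fun x _ => ?_
  by_cases h : Odd x.1
  · rw [if_pos h, if_pos h]
    exact sum_splitWt hq x.2 h
  · rw [if_neg h, if_neg h]

theorem altWt_two (hq : q ^ 4 = 0) : altWt q 2 = 1 := by
  have : Finset.HasAntidiagonal.antidiagonal 1 = {(0, 1), (1, 0)} := rfl
  rw [altWt_succ hq one_ne_zero, this]
  simp [altWt_one, altWt_zero, tailWt]

theorem endWt_eq_zero {n : ℕ} (hn : n < 3) : endWt q n = 0 := by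
  classical
  rw [endWt, valleyWt]
  refine Finset.sum_eq_zero fun σ hσ => if_neg ?_
  rintro ⟨s, y, rfl⟩
  have := length_of_mem_altWords hσ
  simp at this
  omega

/-- Because of the factor `q ^ 3` only words without occurrences count, so the letters before the
maximum must all exceed those after it. -/
theorem endWt_succ (hq : q ^ 4 = 0) {N : ℕ} (hN : N ≠ 0) : q ^ 3 * endWt q (N + 1) =
    ∑ x ∈ Finset.HasAntidiagonal.antidiagonal N, if Odd x.1 then
      q ^ 3 * (altWt q x.1 * endWt q x.2 + if x.2 = 1 then altWt q (x.1 - 1) else 0) else 0 := by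
  classical
  rw [endWt, valleyWt, Finset.mul_sum, sum_altWords_range_succ hN]
  refine Finset.sum_congr rfl fun x _ => ?_
  obtain ⟨k, j⟩ := x
  dsimp only
  by_cases hk : Odd k
  swap; · rw [if_neg hk, if_neg hk]
  rw [if_pos hk, if_pos hk]
  have hk1 := hk.pos
  have hblock : Finset.Ico j (k + j) ∈ (Finset.range (k + j)).powersetCard k := by
    rw [Finset.mem_powersetCard]
    exact ⟨fun a => by simp, by simp⟩
  have hcompl : Finset.range (k + j) \ Finset.Ico j (k + j) = Finset.range j := by
    ext; simp; omega
  rw [Finset.sum_eq_single_of_mem _ hblock, hcompl]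
  · have hocc : ∀ σ ∈ altWords (Finset.Ico j (k + j)), ∀ τ ∈ altWords (Finset.range j),
        occL (σ ++ (k + j) :: τ) = occL σ + occL τ := by
      intro σ hσ τ hτ
      have h1 : ∀ a ∈ σ, j ≤ a ∧ a < k + j := fun a ha => by
        simpa using (mem_iff_of_mem_altWords hσ).1 ha
      have h2 : ∀ a ∈ τ, a < j := fun a ha => by
        simpa using (mem_iff_of_mem_altWords hτ).1 ha
      refine occL_split_of_gt (fun a ha b hb => ?_) (fun a ha => (h1 a ha).2) (fun a ha => ?_)
      · have := h1 a ha; have := h2 b hb; omega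
      · have := h2 a ha; omega
    have hwt : wt q (Finset.Ico j (k + j)) = altWt q k := wt_eq_of_card q (by simp)
    rcases lt_trichotomy j 1 with hj | rfl | hj
    · obtain rfl : j = 0 := by omega
      rw [endWt_eq_zero (by omega), mul_zero, if_neg (by omega), add_zero (0 : R), mul_zero]
      refine Finset.sum_eq_zero fun σ hσ => Finset.sum_eq_zero fun τ hτ => ?_
      rw [if_neg, mul_zero]
      rintro ⟨s, y, h⟩
      have hτ' := length_of_mem_altWords hτ
      rw [Finset.card_range, List.length_eq_zero_iff] at hτ'
      subst hτ'
      have := congrArg List.getLast? h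
      simp at this
      omega
    -- With one letter after the maximum, the maximum is itself the letter between `1` and `0`, and
    -- `σ` must end with its smallest letter `1`.
    · rw [endWt_eq_zero (by omega), mul_zero, zero_add, if_pos rfl, altWords_range_one]
      simp only [Finset.sum_singleton]
      have hcard : (Finset.Ico 2 (k + 1)).card = k - 1 := by rw [Nat.card_Ico]; omega
      rw [sum_altWords_suffix (T := Finset.Ico 2 (k + 1)) (w := [1]),
        altWt, ← wt_eq_of_card q hcard, wt, Finset.mul_sum]
      · refine Finset.sum_congr rfl fun s hs => ?_
        have h1 : ∀ a ∈ s, 2 ≤ a := fun a ha => by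
          have := (mem_iff_of_mem_altWords hs).1 ha
          simp at this; omega
        have h2 : ∀ a ∈ s, a < k + 1 := fun a ha => by
          have := (mem_iff_of_mem_altWords hs).1 ha
          simp at this; omega
        rw [if_pos ⟨s, k + 1, by simp⟩, occL_split_of_gt, occL_append_eq_add]
        · simp [occL, invAbove]
        · intro a ha b hb c hc
          have := h1 a ha
          simp only [List.mem_singleton] at hc
          omega
        · intro a ha
          simp [invAbove]
        · intro a ha b hb
          simp only [List.mem_append, List.mem_singleton] at ha hb
          rcases ha with ha | rfl
          · have := h1 a ha; omega
          · omega
        · intro a ha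
          simp only [List.mem_append, List.mem_singleton] at ha
          rcases ha with ha | rfl
          · exact h2 a ha
          · omega
        · simp
      · ext; simp; omega
      · rw [hcard]; obtain ⟨c, rfl⟩ := hk; simp
      · trivial
      · simp
      · simp only [Finset.mem_Ico, List.mem_singleton]; omega
      · intro σ hσ hne
        rw [if_neg, mul_zero]
        rintro ⟨s, y, h⟩
        have : [1, y, 0] <:+ σ ++ [k + 1, 0] := ⟨s, h.symm⟩
        refine hne s ?_
        have h' : σ ++ [k + 1, 0] = (s ++ [1]) ++ [y, 0] := by simpa using h
        exact (List.append_inj' h' rfl).1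
    -- With at least two letters after the maximum, the prescribed ending lies inside `τ`: otherwise
    -- the maximum `k + j` would be the letter `1`.
    · rw [if_neg (by omega), add_zero, ← hwt, endWt, valleyWt, wt, Finset.sum_mul_sum,
        Finset.mul_sum]
      refine Finset.sum_congr rfl fun σ hσ => ?_
      rw [Finset.mul_sum]
      refine Finset.sum_congr rfl fun τ hτ => ?_
      rw [mul_ite _ (q ^ occL σ), mul_zero, hocc σ hσ τ hτ, pow_add]
      congr 1
      refine if_congr ⟨?_, ?_⟩ rfl rfl
      · rintro ⟨s, y, h⟩
        have hτl := length_of_mem_altWords hτ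
        rw [Finset.card_range] at hτl
        have h1 : τ <:+ σ ++ (k + j) :: τ := ⟨σ ++ [k + j], by simp⟩
        have h2 : [1, y, 0] <:+ σ ++ (k + j) :: τ := ⟨s, h.symm⟩
        rcases Nat.lt_or_ge τ.length 3 with h3 | h3
        · have := List.suffix_of_suffix_length_le (l₁ := (k + j) :: τ) ⟨σ, rfl⟩ h2 (by simp; omega)
          have := this.eq_of_length (by simp; omega)
          simp at this
          omega
        · obtain ⟨s', hs'⟩ := List.suffix_of_suffix_length_le h2 h1 (by simpa using h3)
          exact ⟨s', y, hs'.symm⟩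
      · rintro ⟨s, y, rfl⟩
        exact ⟨σ ++ (k + j) :: s, y, by simp⟩
  · intro S hS hne
    refine Finset.sum_eq_zero fun σ hσ => Finset.sum_eq_zero fun τ hτ => ?_
    split_ifs with h
    swap; · rw [mul_zero]
    rw [← pow_add]
    refine pow_eq_zero_of_le (m := 4) ?_ hq
    obtain ⟨hSN, hcard⟩ := Finset.mem_powersetCard.1 hS
    have hlt : ∀ a ∈ S, a < k + j := fun a ha => Finset.mem_range.1 (hSN ha)
    -- Any set other than the block of the `k` largest letters below the maximum yields an
    -- occurrence `a, k + j, b`, which raises the exponent to at least four.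
    obtain ⟨a, ha, b, hb, hab⟩ : ∃ a ∈ S, ∃ b ∈ Finset.range (k + j) \ S, a < b := by
      by_contra! H
      have hr := eq_range_of_forall_lt (N := k + j) (A := Finset.range (k + j) \ S) (by simp; tauto)
        (by
          intro b hb a haN haS
          have ha : a ∈ S := by simpa [haN] using haS
          refine lt_of_le_of_ne (H a ha b hb) ?_
          rintro rfl
          exact haS hb)
      rw [Finset.card_sdiff_of_subset hSN, hcard, Finset.card_range, Nat.add_sub_cancel_left] at hr
      refine hne ?_
      ext a
      have := Finset.ext_iff.1 hr a
      simp only [Finset.mem_sdiff, Finset.mem_range] at this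
      have := hlt a
      rw [Finset.mem_Ico]
      grind
    have hbN : b < k + j := by simpa using (Finset.mem_sdiff.1 hb).1
    have ha' : [a].Sublist σ := List.singleton_sublist.2 ((mem_iff_of_mem_altWords hσ).2 ha)
    have hb' : [b].Sublist τ := List.singleton_sublist.2 ((mem_iff_of_mem_altWords hτ).2 hb)
    have : 1 ≤ occL (σ ++ (k + j) :: τ) :=
      (by decide : 1 ≤ occL [0, 2, 1]).trans (le_occL_of_sublist [a, b, k + j] [0, 2, 1]
        (by simp; omega) (by simp) (ha'.append (hb'.cons_cons (k + j))))
    omega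

end AltPerm

/-! ### Functional equations for the generating functions in `q` and the length. -/

namespace AltPerm
open PowerSeries (C coeff)

section
variable {R : Type*} [CommRing R] {q : R}

/-- The generating function of the alternating words by length and occurrences of 1-3-2, with an
additional weight depending on the length. -/
noncomputable def altGF (χ : ℕ → R) (q : R) : R⟦X⟧ := PowerSeries.mk fun n => χ n * altWt q n

/-- The indicator function of the odd numbers. -/
def oddInd (R : Type*) [CommRing R] (n : ℕ) : R := if Odd n then 1 else 0

/-- The indicator function of the even numbers. -/
def evenInd (R : Type*) [CommRing R] (n : ℕ) : R := if Even n then 1 else 0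

theorem oddInd_add_two (n : ℕ) : oddInd R (n + 2) = oddInd R n := by
  simp [oddInd, parity_simps]

theorem evenInd_add_two (n : ℕ) : evenInd R (n + 2) = evenInd R n := by
  simp [evenInd, parity_simps]

/-- The generating function of the numbers `tailWt`. -/
noncomputable def tailGF (χ : ℕ → R) (q : R) : R⟦X⟧ :=
  C q * (altGF χ q - C (χ 0)) + C (q ^ 2) * (altGF χ q - C (χ 0) - C (χ 1) * PowerSeries.X) -
    C (q ^ 3) * (PowerSeries.X ^ 2 * (altGF χ q - C (χ 0))) +
    C (q ^ 3) * (altGF χ q - C (χ 0) - C (χ 1) * PowerSeries.X - C (χ 0) * PowerSeries.X ^ 2 -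
      PowerSeries.X ^ 2 * (altGF χ q - C (χ 0)))

theorem coeff_tailGF (hq : q ^ 4 = 0) {χ : ℕ → R} (hχ : ∀ n, χ (n + 2) = χ n) (j : ℕ) :
    coeff j (tailGF χ q) = χ j * tailWt q j := by
  have h2 := hχ 0
  rw [zero_add] at h2
  match j with
  | 0 => simp [tailGF, altGF, tailWt, altWt_zero, -map_pow]; simp
  | 1 => simp [tailGF, altGF, tailWt, altWt_one, PowerSeries.coeff_X_pow,
      PowerSeries.coeff_X_pow_mul', -map_pow, mul_comm]
  | 2 =>
    simp [tailGF, altGF, tailWt, altWt_two hq, PowerSeries.coeff_X_pow,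
      PowerSeries.coeff_X_pow_mul', -map_pow, h2, altWt_zero]
    ring
  | i + 3 =>
    simp [tailGF, altGF, tailWt, PowerSeries.coeff_X_pow,
      PowerSeries.coeff_X_pow_mul', -map_pow, hχ (i + 1)]
    ring

/-- The generating function of the words of odd length counted by `endWt`. -/
noncomputable def endGF (q : R) : R⟦X⟧ := PowerSeries.mk fun n => if Odd n then endWt q n else 0

theorem coeff_X_mul_even (k : ℕ) : coeff k (PowerSeries.X * altGF (evenInd R) q) =
    if Odd k then altWt q (k - 1) else 0 := by
  match k with
  | 0 => simp
  | k + 1 => simp [PowerSeries.coeff_succ_X_mul, altGF, evenInd, parity_simps]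

theorem coeff_X_pow_three_mul_even (k : ℕ) : coeff k (PowerSeries.X ^ 3 * altGF (evenInd R) q) =
    if Odd k then if 3 ≤ k then altWt q (k - 3) else 0 else 0 := by
  rw [PowerSeries.coeff_X_pow_mul']
  by_cases h3 : 3 ≤ k
  · obtain ⟨c, rfl⟩ := Nat.exists_eq_add_of_le' h3
    simp [altGF, evenInd, parity_simps]
  · simp [h3]

/-- The 2-periodic weight `χ` lets one identity serve for even and odd lengths. -/
theorem altGF_eq (hq : q ^ 4 = 0) {χ : ℕ → R} (hχ : ∀ n, χ (n + 2) = χ n) :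
    altGF χ q = C (χ 0) + C (χ 1) * PowerSeries.X + PowerSeries.X *
      (altGF (oddInd R) q * altGF χ q + PowerSeries.X * altGF (evenInd R) q * tailGF χ q +
        C (q ^ 3) * ((endGF q + PowerSeries.X ^ 3 * altGF (evenInd R) q) *
          (altGF χ q - C (χ 0)))) := by
  -- With `k` odd, the part after the maximum has the same length parity as the whole word, so the
  -- weight passes to the second factor.
  have hχ' : ∀ k j, Odd k → χ (k + j + 1) = χ j := by
    rintro k j ⟨c, rfl⟩
    induction c with
    | zero => exact (congrArg χ (by omega)).trans (hχ j)
    | succ c ih => exact (congrArg χ (by omega)).trans ((hχ (2 * c + 1 + j + 1)).trans ih)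
  ext n
  match n with
  | 0 => simp [altGF, altWt_zero]
  | N + 1 =>
    have hc : coeff (N + 1) (C (χ 0) + C (χ 1) * PowerSeries.X : R⟦X⟧) =
        if N = 0 then χ 1 else 0 := by
      simp [PowerSeries.coeff_C]
    rw [map_add, hc, PowerSeries.coeff_succ_X_mul, map_add, map_add,
      PowerSeries.coeff_C_mul _ _ (q ^ 3),
      PowerSeries.coeff_mul, PowerSeries.coeff_mul, PowerSeries.coeff_mul]
    rcases eq_or_ne N 0 with rfl | hN
    · simp [altGF, altWt_one, oddInd, endGF]
    · rw [Finset.mul_sum, ← Finset.sum_add_distrib, ← Finset.sum_add_distrib, altGF,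
        PowerSeries.coeff_mk, altWt_succ hq hN, Finset.mul_sum]
      rw [if_neg hN, zero_add]
      refine Finset.sum_congr rfl fun x hx => ?_
      obtain ⟨k, j⟩ := x
      rw [Finset.HasAntidiagonal.mem_antidiagonal] at hx
      dsimp only at hx ⊢
      subst hx
      rw [map_add, coeff_X_mul_even, coeff_X_pow_three_mul_even, coeff_tailGF hq hχ, map_sub]
      simp only [altGF, endGF, PowerSeries.coeff_mk, oddInd, PowerSeries.coeff_C]
      by_cases hk : Odd k
      · simp only [if_pos hk, hχ' k j hk]
        rcases j with - | j
        · simp [altWt_zero]; ring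
        · simp; ring
      · simp [hk]

theorem endGF_eq (hq : q ^ 4 = 0) : C (q ^ 3) * endGF q = C (q ^ 3) *
    (PowerSeries.X ^ 3 * altGF (evenInd R) q + PowerSeries.X * (altGF (oddInd R) q * endGF q)) := by
  have : PowerSeries.X ^ 3 * altGF (evenInd R) q =
      PowerSeries.X * (PowerSeries.X * altGF (evenInd R) q * PowerSeries.X) := by ring
  rw [this, ← mul_add]
  ext n
  match n with
  | 0 => simp [endGF]
  | N + 1 =>
    rw [PowerSeries.coeff_C_mul, PowerSeries.coeff_C_mul, PowerSeries.coeff_succ_X_mul, map_add,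
      PowerSeries.coeff_mul, PowerSeries.coeff_mul, ← Finset.sum_add_distrib]
    rcases eq_or_ne N 0 with rfl | hN
    · simp [endGF, endWt_eq_zero]
    · rw [endGF, PowerSeries.coeff_mk, mul_ite, mul_zero, endWt_succ hq hN, Finset.mul_sum]
      by_cases hodd : Odd (N + 1)
      · rw [if_pos hodd]
        refine Finset.sum_congr rfl fun x hx => ?_
        obtain ⟨k, j⟩ := x
        rw [Finset.HasAntidiagonal.mem_antidiagonal] at hx
        dsimp only at hx ⊢
        subst hx
        rw [coeff_X_mul_even]
        simp only [altGF, PowerSeries.coeff_mk, oddInd, PowerSeries.coeff_X]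
        by_cases hk : Odd k
        · have hj : Odd j := by rw [Nat.odd_iff] at hodd hk ⊢; omega
          simp only [if_pos hk, if_pos hj]
          split_ifs <;> ring
        · simp [hk]
      · rw [if_neg hodd]
        symm
        refine Finset.sum_eq_zero fun x hx => ?_
        obtain ⟨k, j⟩ := x
        rw [Finset.HasAntidiagonal.mem_antidiagonal] at hx
        dsimp only at hx ⊢
        subst hx
        rw [coeff_X_mul_even]
        simp only [altGF, PowerSeries.coeff_mk, oddInd, PowerSeries.coeff_X]
        by_cases hk : Odd k
        · have hj : ¬ Odd j := by rw [Nat.odd_iff] at hodd hk ⊢; omega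
          have hj1 : j ≠ 1 := by rintro rfl; exact hj odd_one
          simp [hj, hj1]
        · simp [hk]

end
end AltPerm

/-! ### From words to permutations. -/

namespace AltPerm

theorem countP_ofFn {n : ℕ} (f : Fin n → ℕ) (p : ℕ → Prop) [DecidablePred p] :
    (List.ofFn f).countP (fun c => p c) = ∑ k, if p (f k) then 1 else 0 := by
  induction n with
  | zero => simp
  | succ n ih => 
    rw [List.ofFn_succ, List.countP_cons, ih, Fin.sum_univ_succ, add_comm]; simp

theorem invAbove_ofFn {n : ℕ} (f : Fin n → ℕ) (a : ℕ) :
    invAbove a (List.ofFn f) = ∑ j, ∑ k, if j < k ∧ a < f k ∧ f k < f j then 1 else 0 := by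
  induction n with
  | zero => simp [invAbove]
  | succ n ih => rw [List.ofFn_succ, invAbove, countP_ofFn, ih]; simp [Fin.sum_univ_succ, -Finset.sum_boole]

theorem occL_ofFn {n : ℕ} (f : Fin n → ℕ) : occL (List.ofFn f) =
    ∑ i, ∑ j, ∑ k, if i < j ∧ j < k ∧ f i < f k ∧ f k < f j then 1 else 0 := by
  induction n with
  | zero => simp [occL]
  | succ n ih => rw [List.ofFn_succ, occL, invAbove_ofFn, ih]; simp [Fin.sum_univ_succ, -Finset.sum_boole]

/-- The one-line notation of a permutation. -/
def toWord {n : ℕ} (π : Equiv.Perm (Fin n)) : List ℕ := List.ofFn fun i => (π i : ℕ)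

theorem pattern_iff {n : ℕ} (π : Equiv.Perm (Fin n)) (f : Fin 3 → Fin n) :
    ((∀ a b, a < b → f a < f b) ∧ ∀ a b, π (f a) < π (f b) ↔ pat132 a < pat132 b) ↔
      f 0 < f 1 ∧ f 1 < f 2 ∧ π (f 0) < π (f 2) ∧ π (f 2) < π (f 1) := by
  have h0 : pat132 0 = 0 := rfl
  have h1 : pat132 1 = 2 := rfl
  have h2 : pat132 2 = 1 := rfl
  constructor
  · rintro ⟨h, h'⟩
    exact ⟨h 0 1 (by decide), h 1 2 (by decide), (h' 0 2).2 (by decide), (h' 2 1).2 (by decide)⟩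
  · rintro ⟨h3, h4, h5, h6⟩
    constructor
    · intro a b hab
      fin_cases a <;> fin_cases b <;> simp at hab ⊢ <;> omega
    · intro a b
      fin_cases a <;> fin_cases b <;> simp [h0, h1, h2] <;> omega

theorem occL_toWord {n : ℕ} (π : Equiv.Perm (Fin n)) : occL (toWord π) = occ pat132 π := by
  rw [toWord, occL_ofFn, occ]
  simp_rw [pattern_iff]
  simp_rw [← Fintype.sum_prod_type']
  rw [← Finset.card_filter]
  refine Finset.card_nbij' (fun x => ![x.1, x.2.1, x.2.2]) (fun f => (f 0, f 1, f 2)) ?_ ?_ ?_ ?_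
  · rintro ⟨i, j, k⟩ h
    simpa using h
  · intro f h
    simpa using h
  · rintro ⟨i, j, k⟩ h
    rfl
  · intro f h
    ext i
    fin_cases i <;> rfl

theorem alt_toWord {n : ℕ} (π : Equiv.Perm (Fin n)) : Alt (toWord π) ↔ IsAlternating π := by
  rw [alt_iff_getElem, IsAlternating]
  constructor
  · intro h i hi
    simpa [toWord] using h i (by simpa [toWord] using hi)
  · intro h i hi
    simpa [toWord] using h i (by simpa [toWord] using hi)

/-- The number of alternating words of length `n` with `r` occurrences of 1-3-2. -/
noncomputable def altCount (n r : ℕ) : ℕ := ((altWords (Finset.range n)).filter (occL · = r)).card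

theorem card_alternating (n r : ℕ) (p : Equiv.Perm (Fin n) → Prop) [DecidablePred p]
    (hp : ∀ π, p π ↔ IsAlternating π ∧ occ pat132 π = r) :
    (Finset.univ.filter p).card = altCount n r := by
  rw [altCount]
  refine Finset.card_nbij toWord ?_ ?_ ?_
  · intro π h
    rw [Finset.mem_coe, Finset.mem_filter, hp] at h
    simp only [Finset.mem_coe, Finset.mem_filter, mem_altWords, occL_toWord, alt_toWord, h, and_true]
    constructor
    · rw [toWord, List.nodup_ofFn]
      exact Fin.val_injective.comp π.injective
    · ext a
      simp only [toWord, List.mem_toFinset, List.mem_ofFn, Finset.mem_range]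
      constructor
      · rintro ⟨i, rfl⟩; exact (π i).2
      · intro ha; exact ⟨π.symm ⟨a, ha⟩, by simp⟩
  · intro π _ π' _ h
    rw [toWord, toWord, List.ofFn_inj] at h
    ext i
    exact congrFun h i
  · intro l hl
    rw [Finset.mem_coe, Finset.mem_filter] at hl
    obtain ⟨hl, hr⟩ := hl
    have hlen := length_of_mem_altWords hl
    rw [Finset.card_range] at hlen
    obtain ⟨hn, hS, hA⟩ := mem_altWords.1 hl
    have hlt : ∀ i : Fin n, l[i]'(by omega) < n := fun i => by
      simpa using (mem_iff_of_mem_altWords hl).1 (List.getElem_mem (l := l) (n := i) (by omega))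
    let g : Fin n → Fin n := fun i => ⟨l[i]'(by omega), hlt i⟩
    have hg : Function.Injective g := by
      intro i j hij
      have : l[(i : ℕ)]'(by omega) = l[(j : ℕ)]'(by omega) := by simpa [g] using hij
      exact Fin.ext ((hn.getElem_inj_iff).1 this)
    let π : Equiv.Perm (Fin n) := Equiv.ofBijective g (Finite.injective_iff_bijective.1 hg)
    have hπ : toWord π = l := by
      refine List.ext_getElem (by simp [toWord, hlen]) fun i h1 h2 => ?_
      simp [toWord, π, g]
    refine ⟨π, ?_, hπ⟩
    rw [Finset.coe_filter, Set.mem_ofPred_eq, hp, ← alt_toWord, ← occL_toWord, hπ]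
    exact ⟨Finset.mem_univ _, hA, hr⟩

/-- The parity of the last position fixes the direction of the last step. -/
theorem isUpDown_iff {n : ℕ} (π : Equiv.Perm (Fin n)) :
    IsUpDown π ↔ IsAlternating π ∧ Odd n ∧ n ≠ 1 := by
  rw [IsUpDown]
  refine and_congr_right fun h => ?_
  constructor
  · rintro ⟨h2, h3⟩
    refine ⟨?_, by omega⟩
    by_contra hodd
    obtain ⟨m, rfl⟩ : ∃ m, n = m + 2 := ⟨n - 2, by omega⟩
    have := (h m (by omega)).1 (by simpa [parity_simps] using hodd)
    exact absurd h3 this.not_gt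
  · rintro ⟨hodd, hn⟩
    have hn2 : 2 ≤ n := by have := hodd.pos; omega
    obtain ⟨m, rfl⟩ : ∃ m, n = m + 2 := ⟨n - 2, by omega⟩
    exact ⟨hn2, (h m (by omega)).2 (by simpa [parity_simps] using hodd)⟩

theorem isUpUp_iff {n : ℕ} (π : Equiv.Perm (Fin n)) :
    IsUpUp π ↔ IsAlternating π ∧ Even n ∧ n ≠ 0 := by
  rw [IsUpUp]
  refine and_congr_right fun h => ?_
  constructor
  · rintro ⟨h2, h3⟩
    refine ⟨?_, by omega⟩
    by_contra hodd
    obtain ⟨m, rfl⟩ : ∃ m, n = m + 2 := ⟨n - 2, by omega⟩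
    have := (h m (by omega)).2 (by simpa [parity_simps] using hodd)
    exact absurd h3 this.not_gt
  · rintro ⟨heven, hn⟩
    have hn2 : 2 ≤ n := by obtain ⟨c, rfl⟩ := heven; omega
    obtain ⟨m, rfl⟩ : ∃ m, n = m + 2 := ⟨n - 2, by omega⟩
    exact ⟨hn2, (h m (by omega)).1 (by simpa [parity_simps] using heven)⟩

/-- The generating function of the alternating words with `r` occurrences of 1-3-2, with an
additional weight depending on the length. -/
noncomputable def altSeries (χ : ℕ → ℚ) (r : ℕ) : ℚ⟦X⟧ :=
  PowerSeries.mk fun n => χ n * altCount n r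

theorem altCount_zero (r : ℕ) : altCount 0 r = if r = 0 then 1 else 0 := by
  rw [altCount, altWords_range_zero, Finset.filter_singleton]
  simp only [occL, eq_comm]
  split_ifs <;> rfl

theorem altCount_one (r : ℕ) : altCount 1 r = if r = 0 then 1 else 0 := by
  rw [altCount, altWords_range_one, Finset.filter_singleton]
  simp only [occL, invAbove, add_zero, eq_comm]
  split_ifs <;> rfl

theorem A_eq (r : ℕ) : A r = altSeries (evenInd ℚ) r + altSeries (oddInd ℚ) r := by
  classical
  ext n
  rw [map_add, A, altSeries, altSeries, PowerSeries.coeff_mk, PowerSeries.coeff_mk,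
    PowerSeries.coeff_mk, card_alternating n r _ fun π => Iff.rfl]
  rcases Nat.even_or_odd n with h | h
  · simp [evenInd, oddInd, h, Nat.not_odd_iff_even.2 h]
  · simp [evenInd, oddInd, h, Nat.not_even_iff_odd.2 h]

/-- The correction `X` removes the permutation of length one, which is alternating without
occurrences but not up-down. -/
theorem UD_eq (r : ℕ) :
    UD r = altSeries (oddInd ℚ) r - if r = 0 then PowerSeries.X else 0 := by
  classical
  ext n
  rw [map_sub, UD, altSeries, PowerSeries.coeff_mk, PowerSeries.coeff_mk]
  simp_rw [isUpDown_iff]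
  by_cases h : Odd n ∧ n ≠ 1
  · rw [card_alternating n r _ fun π => by tauto]
    split_ifs <;> simp [oddInd, h, PowerSeries.coeff_X]
  · rw [Finset.filter_false_of_mem (by tauto)]
    by_cases h1 : n = 1
    · subst h1
      rw [altCount_one]
      split_ifs <;> simp [oddInd]
    · have : ¬ Odd n := by tauto
      split_ifs <;> simp [oddInd, this, PowerSeries.coeff_X, h1]

/-- The correction `1` removes the empty permutation. -/
theorem UU_eq (r : ℕ) : UU r = altSeries (evenInd ℚ) r - if r = 0 then 1 else 0 := by
  classical
  ext n
  rw [map_sub, UU, altSeries, PowerSeries.coeff_mk, PowerSeries.coeff_mk]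
  simp_rw [isUpUp_iff]
  by_cases h : Even n ∧ n ≠ 0
  · rw [card_alternating n r _ fun π => by tauto]
    split_ifs <;> simp [evenInd, h, PowerSeries.coeff_one]
  · rw [Finset.filter_false_of_mem (by tauto)]
    by_cases h1 : n = 0
    · subst h1
      rw [altCount_zero]
      split_ifs <;> simp [evenInd]
    · have : ¬ Even n := by tauto
      split_ifs <;> simp [evenInd, this, PowerSeries.coeff_one, h1]

end AltPerm

/-! ### Separating the powers of `q`. -/

namespace AltPerm
open PowerSeries (C coeff)

/-- Expands the functional equation in powers of the nilpotent `a`, to be used with `a = C q`; the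
four brackets are the equations for `r = 0, 1, 2, 3`. -/
theorem trunc_expand {S : Type*} [CommRing S]
    (a x c₀ c₁ u₀ u₁ u₂ u₃ o₀ o₁ o₂ o₃ t₀ t₁ t₂ t₃ u o t : S) (ha : a ^ 4 = 0)
    (hu : u = u₀ + a * u₁ + a ^ 2 * u₂ + a ^ 3 * u₃)
    (ho : o = o₀ + a * o₁ + a ^ 2 * o₂ + a ^ 3 * o₃)
    (ht : t = t₀ + a * t₁ + a ^ 2 * t₂ + a ^ 3 * t₃) :
    t - (c₀ + c₁ * x + x * (o * t + x * u * (a * (t - c₀) + a ^ 2 * (t - c₀ - c₁ * x) -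
      a ^ 3 * (x ^ 2 * (t - c₀)) + a ^ 3 * (t - c₀ - c₁ * x - c₀ * x ^ 2 - x ^ 2 * (t - c₀))) +
      a ^ 3 * (x ^ 3 * (u ^ 2 + u) * (t - c₀)))) =
    (t₀ - (c₀ + c₁ * x + x * (o₀ * t₀))) +
    a * (t₁ - (x * (o₀ * t₁ + o₁ * t₀) + x ^ 2 * (u₀ * (t₀ - c₀)))) +
    a ^ 2 * (t₂ - (x * (o₀ * t₂ + o₁ * t₁ + o₂ * t₀) +
      x ^ 2 * (u₀ * t₁ + u₁ * (t₀ - c₀) + u₀ * (t₀ - c₀ - c₁ * x)))) +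
    a ^ 3 * (t₃ - (x * (o₀ * t₃ + o₁ * t₂ + o₂ * t₁ + o₃ * t₀) +
      x ^ 2 * (u₀ * t₂ + u₁ * t₁ + u₂ * (t₀ - c₀) + u₀ * t₁ + u₁ * (t₀ - c₀ - c₁ * x) -
        u₀ * (x ^ 2 * (t₀ - c₀)) +
        u₀ * (t₀ - c₀ - c₁ * x - c₀ * x ^ 2 - x ^ 2 * (t₀ - c₀))) +
      x ^ 4 * ((u₀ ^ 2 + u₀) * (t₀ - c₀)))) := by
  subst hu ho ht
  -- The coefficient is the quotient by `a ^ 4` of everything that the truncation drops.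
  linear_combination (-(x * (o₁ * t₃ + o₂ * t₂ + o₃ * t₁ + a * (o₂ * t₃ + o₃ * t₂) + a ^ 2 * (o₃
    * t₃)) + x ^ 2 * ((u₀ * t₃ + u₁ * t₂ + u₂ * t₁ + u₃ * (t₀ - c₀)) + a * (u₁ * t₃ + u₂ * t₂ +
    u₃ * t₁ + a * (u₂ * t₃ + u₃ * t₂) + a ^ 2 * (u₃ * t₃)) + (u₀ * t₂ + u₁ * t₁ + u₂ * (t₀ - c₀
    - c₁ * x)) + a * (u₀ * t₃ + u₁ * t₂ + u₂ * t₁ + u₃ * (t₀ - c₀ - c₁ * x)) + a ^ 2 * (u₁ * t₃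
    + u₂ * t₂ + u₃ * t₁ + a * (u₂ * t₃ + u₃ * t₂) + a ^ 2 * (u₃ * t₃)) + (u₀ * ((1 - 2 * x ^ 2)
    * t₁) + u₁ * ((1 - 2 * x ^ 2) * (t₀ - c₀) - c₁ * x - c₀ * x ^ 2)) + a * (u₀ * ((1 - 2 * x ^
    2) * t₂) + u₁ * ((1 - 2 * x ^ 2) * t₁) + u₂ * ((1 - 2 * x ^ 2) * (t₀ - c₀) - c₁ * x - c₀ * x
    ^ 2)) + a ^ 2 * (u₀ * ((1 - 2 * x ^ 2) * t₃) + u₁ * ((1 - 2 * x ^ 2) * t₂) + u₂ * ((1 - 2 *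
    x ^ 2) * t₁) + u₃ * ((1 - 2 * x ^ 2) * (t₀ - c₀) - c₁ * x - c₀ * x ^ 2)) + a ^ 3 * (u₁ * ((1
    - 2 * x ^ 2) * t₃) + u₂ * ((1 - 2 * x ^ 2) * t₂) + u₃ * ((1 - 2 * x ^ 2) * t₁) + a * (u₂ *
    ((1 - 2 * x ^ 2) * t₃) + u₃ * ((1 - 2 * x ^ 2) * t₂)) + a ^ 2 * (u₃ * ((1 - 2 * x ^ 2) *
    t₃)))) + x ^ 4 * ((u₁ + a * u₂ + a ^ 2 * u₃) * ((u₀ + a * u₁ + a ^ 2 * u₂ + a ^ 3 * u₃) + u₀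
    + 1) * (t₀ - c₀ + a * t₁ + a ^ 2 * t₂ + a ^ 3 * t₃) + (u₀ ^ 2 + u₀) * (t₁ + a * t₂ + a ^ 2 *
    t₃)))) * ha

section
variable {R : Type*} [CommRing R] {q : R}

/-- The equation for `altGF` without `endGF`. -/
theorem altGF_eq' (hq : q ^ 4 = 0) {χ : ℕ → R} (hχ : ∀ n, χ (n + 2) = χ n) :
    altGF χ q - (C (χ 0) + C (χ 1) * PowerSeries.X + PowerSeries.X *
      (altGF (oddInd R) q * altGF χ q + PowerSeries.X * altGF (evenInd R) q *
        (C q * (altGF χ q - C (χ 0)) + C q ^ 2 * (altGF χ q - C (χ 0) - C (χ 1) * PowerSeries.X) -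
    C q ^ 3 * (PowerSeries.X ^ 2 * (altGF χ q - C (χ 0))) +
    C q ^ 3 * (altGF χ q - C (χ 0) - C (χ 1) * PowerSeries.X - C (χ 0) * PowerSeries.X ^ 2 -
      PowerSeries.X ^ 2 * (altGF χ q - C (χ 0)))) +
        C q ^ 3 * (PowerSeries.X ^ 3 * (altGF (evenInd R) q ^ 2 + altGF (evenInd R) q) *
          (altGF χ q - C (χ 0))))) = 0 := by
  have ha : (C q : R⟦X⟧) ^ 4 = 0 := by rw [← map_pow, hq, map_zero]
  have h1 := altGF_eq hq hχ
  have h2 := altGF_eq hq (evenInd_add_two (R := R))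
  have h3 := endGF_eq hq
  have e0 : evenInd R 0 = 1 := by simp [evenInd]
  have e1 : evenInd R 1 = 0 := by simp [evenInd]
  simp only [tailGF, map_pow, e0, e1, map_one, map_zero, zero_mul, add_zero, sub_zero] at h1 h2 h3
  set U := altGF (evenInd R) q
  set O := altGF (oddInd R) q
  set T := altGF χ q
  set G := endGF q
  -- Multiplied by `q ^ 3`, the equation for `U` reduces to `U (1 - x O) = 1`, while `h3` says `G (1
  -- - x O) = x ^ 3 U`. Eliminating `1 - x O` gives `h5`.
  have h4 : (C q : R⟦X⟧) ^ 3 * U = C q ^ 3 * (1 + PowerSeries.X * O * U) := by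
    linear_combination C q ^ 3 * h2 + (PowerSeries.X ^ 2 * U * ((U - 1) + C q * (U - 1) -
      C q ^ 2 * (PowerSeries.X ^ 2 * (U - 1)) + C q ^ 2 * (U - 1 - PowerSeries.X ^ 2 -
        PowerSeries.X ^ 2 * (U - 1))) +
      C q ^ 2 * PowerSeries.X * ((G + PowerSeries.X ^ 3 * U) * (U - 1))) * ha
  have h5 : (C q : R⟦X⟧) ^ 3 * G = C q ^ 3 * (PowerSeries.X ^ 3 * U ^ 2) := by
    linear_combination U * h3 - G * h4
  linear_combination h1 + PowerSeries.X * (T - C (χ 0)) * h5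

theorem altWt_eq_sum (hq : q ^ 4 = 0) (n : ℕ) : altWt q n = (altCount n 0 : R) +
    q * altCount n 1 + q ^ 2 * altCount n 2 + q ^ 3 * altCount n 3 := by
  have h : ∀ m : ℕ, q ^ m = (if m = 0 then 1 else 0) + q * (if m = 1 then 1 else 0) +
      q ^ 2 * (if m = 2 then 1 else 0) + q ^ 3 * (if m = 3 then 1 else 0) := by
    intro m
    match m with
    | 0 => simp
    | 1 => simp
    | 2 => simp
    | 3 => simp
    | m + 4 => rw [pow_eq_zero_of_le (by omega) hq]; simp
  simp_rw [altWt, wt, h (occL _), Finset.sum_add_distrib, ← Finset.mul_sum, altCount,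
    Finset.sum_boole]

theorem altGF_eq_sum [Algebra ℚ R] (hq : q ^ 4 = 0) (χ : ℕ → ℚ) :
    altGF (fun n => algebraMap ℚ R (χ n)) q =
      PowerSeries.map (algebraMap ℚ R) (altSeries χ 0) +
      C q * PowerSeries.map (algebraMap ℚ R) (altSeries χ 1) +
      C q ^ 2 * PowerSeries.map (algebraMap ℚ R) (altSeries χ 2) +
      C q ^ 3 * PowerSeries.map (algebraMap ℚ R) (altSeries χ 3) := by
  ext n
  simp only [← map_pow C, map_add, PowerSeries.coeff_C_mul, PowerSeries.coeff_map, altSeries,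
    altGF, PowerSeries.coeff_mk, altWt_eq_sum hq, map_mul, map_natCast]
  ring

end

/-- Polynomials in a nilpotent element. -/
abbrev TruncRing : Type := ℚ⟦X⟧ ⧸ Ideal.span {(PowerSeries.X ^ 4 : ℚ⟦X⟧)}

/-- The nilpotent generator of `TruncRing`. -/
noncomputable def truncVar : TruncRing := Ideal.Quotient.mk _ PowerSeries.X

theorem truncVar_pow_four : truncVar ^ 4 = 0 := by
  rw [truncVar, ← map_pow, Ideal.Quotient.eq_zero_iff_mem]
  exact Ideal.mem_span_singleton_self _

/-- The powers `1, q, q ^ 2, q ^ 3` are linearly independent over `ℚ` in `TruncRing`. -/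
theorem eq_zero_of_trunc_eq_zero {e₀ e₁ e₂ e₃ : ℚ}
    (h : algebraMap ℚ TruncRing e₀ + truncVar * algebraMap ℚ TruncRing e₁ +
      truncVar ^ 2 * algebraMap ℚ TruncRing e₂ + truncVar ^ 3 * algebraMap ℚ TruncRing e₃ = 0) :
    e₀ = 0 ∧ e₁ = 0 ∧ e₂ = 0 ∧ e₃ = 0 := by
  have hmap : ∀ e : ℚ, algebraMap ℚ TruncRing e = Ideal.Quotient.mk _ (C e) := fun e => rfl
  rw [truncVar, hmap, hmap, hmap, hmap, ← map_pow, ← map_pow, ← map_mul, ← map_mul, ← map_mul,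
    ← map_add, ← map_add, ← map_add, Ideal.Quotient.eq_zero_iff_mem, Ideal.mem_span_singleton,
    PowerSeries.X_pow_dvd_iff] at h
  refine ⟨?_, ?_, ?_, ?_⟩
  · simpa [PowerSeries.coeff_X_pow_mul'] using h 0 (by omega)
  · simpa [PowerSeries.coeff_X_pow_mul', PowerSeries.coeff_C] using h 1 (by omega)
  · simpa [PowerSeries.coeff_X_pow_mul', PowerSeries.coeff_C, PowerSeries.coeff_X] using
      h 2 (by omega)
  · simpa [PowerSeries.coeff_X_pow_mul', PowerSeries.coeff_C, PowerSeries.coeff_X] using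
      h 3 (by omega)

theorem eq_zero_of_map_trunc_eq_zero {E₀ E₁ E₂ E₃ : ℚ⟦X⟧}
    (h : PowerSeries.map (algebraMap ℚ TruncRing) E₀ +
      C truncVar * PowerSeries.map (algebraMap ℚ TruncRing) E₁ +
      C truncVar ^ 2 * PowerSeries.map (algebraMap ℚ TruncRing) E₂ +
      C truncVar ^ 3 * PowerSeries.map (algebraMap ℚ TruncRing) E₃ = 0) :
    E₀ = 0 ∧ E₁ = 0 ∧ E₂ = 0 ∧ E₃ = 0 := by
  have key : ∀ n, coeff n E₀ = 0 ∧ coeff n E₁ = 0 ∧ coeff n E₂ = 0 ∧ coeff n E₃ = 0 := fun n => by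
    have := congrArg (coeff n) h
    simp only [← map_pow C, map_add, PowerSeries.coeff_C_mul, PowerSeries.coeff_map,
      map_zero] at this
    exact eq_zero_of_trunc_eq_zero this
  refine ⟨?_, ?_, ?_, ?_⟩ <;> ext n <;> simp [key n]

/-- The functional equations of the generating functions. -/
theorem altSeries_equations {χ : ℕ → ℚ} (hχ : ∀ n, χ (n + 2) = χ n)
    {X c₀ c₁ u₀ u₁ u₂ o₀ o₁ o₂ o₃ t₀ t₁ t₂ t₃ : ℚ⟦X⟧} (hX : X = PowerSeries.X)
    (hc₀ : c₀ = C (χ 0)) (hc₁ : c₁ = C (χ 1))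
    (hu₀ : u₀ = altSeries (evenInd ℚ) 0) (hu₁ : u₁ = altSeries (evenInd ℚ) 1)
    (hu₂ : u₂ = altSeries (evenInd ℚ) 2)
    (ho₀ : o₀ = altSeries (oddInd ℚ) 0) (ho₁ : o₁ = altSeries (oddInd ℚ) 1)
    (ho₂ : o₂ = altSeries (oddInd ℚ) 2) (ho₃ : o₃ = altSeries (oddInd ℚ) 3)
    (ht₀ : t₀ = altSeries χ 0) (ht₁ : t₁ = altSeries χ 1)
    (ht₂ : t₂ = altSeries χ 2) (ht₃ : t₃ = altSeries χ 3) :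
    t₀ - (c₀ + c₁ * X + X * (o₀ * t₀)) = 0 ∧
    t₁ - (X * (o₀ * t₁ + o₁ * t₀) + X ^ 2 * (u₀ * (t₀ - c₀))) = 0 ∧
    t₂ - (X * (o₀ * t₂ + o₁ * t₁ + o₂ * t₀) +
      X ^ 2 * (u₀ * t₁ + u₁ * (t₀ - c₀) + u₀ * (t₀ - c₀ - c₁ * X))) = 0 ∧
    t₃ - (X * (o₀ * t₃ + o₁ * t₂ + o₂ * t₁ + o₃ * t₀) +
      X ^ 2 * (u₀ * t₂ + u₁ * t₁ + u₂ * (t₀ - c₀) + u₀ * t₁ + u₁ * (t₀ - c₀ - c₁ * X) -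
        u₀ * (X ^ 2 * (t₀ - c₀)) +
        u₀ * (t₀ - c₀ - c₁ * X - c₀ * X ^ 2 - X ^ 2 * (t₀ - c₀))) +
      X ^ 4 * ((u₀ ^ 2 + u₀) * (t₀ - c₀))) = 0 := by
  have hq := truncVar_pow_four
  have ha : (C truncVar : TruncRing⟦X⟧) ^ 4 = 0 := by rw [← map_pow, hq, map_zero]
  have he : evenInd TruncRing = fun n => algebraMap ℚ TruncRing (evenInd ℚ n) := by
    ext n; simp only [evenInd]; split_ifs <;> simp
  have ho : oddInd TruncRing = fun n => algebraMap ℚ TruncRing (oddInd ℚ n) := by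
    ext n; simp only [oddInd]; split_ifs <;> simp
  have h1 := altGF_eq' hq (χ := fun n => algebraMap ℚ TruncRing (χ n)) fun n => by rw [hχ]
  have hU := altGF_eq_sum hq (evenInd ℚ)
  have hO := altGF_eq_sum hq (oddInd ℚ)
  have hT := altGF_eq_sum hq χ
  rw [← he] at hU
  rw [← ho] at hO
  rw [trunc_expand _ _ _ _ _ _ _ _ _ _ _ _ _ _ _ _ _ _ _ ha hU hO hT] at h1
  refine eq_zero_of_map_trunc_eq_zero ?_
  subst hX hc₀ hc₁ hu₀ hu₁ hu₂ ho₀ ho₁ ho₂ ho₃ ht₀ ht₁ ht₂ ht₃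
  simpa only [map_sub, map_add, map_mul, map_pow, PowerSeries.map_X, PowerSeries.map_C] using h1

end AltPerm

/-! ### Binomial powers of `1 - 4 x ^ 2`, and solution of the system. -/

namespace AltPerm
open PowerSeries (C coeff)

theorem hasSubst_neg_four_mul : PowerSeries.HasSubst (-4 * PowerSeries.X ^ 2 : ℚ⟦X⟧) :=
  PowerSeries.HasSubst.of_constantCoeff_zero' (by simp)

/-- `S e` as a power series. -/
noncomputable def binomPow (e : ℚ) : ℚ⟦X⟧ :=
  (PowerSeries.binomialSeries ℚ e).subst (-4 * PowerSeries.X ^ 2 : ℚ⟦X⟧)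

theorem binomPow_add (e f : ℚ) : binomPow (e + f) = binomPow e * binomPow f := by
  rw [binomPow, PowerSeries.binomialSeries_add, PowerSeries.subst_mul hasSubst_neg_four_mul]; rfl

theorem binomPow_zero : binomPow 0 = 1 := by
  rw [binomPow, PowerSeries.binomialSeries_zero, ← PowerSeries.coe_substAlgHom hasSubst_neg_four_mul,
    map_one]

theorem binomPow_one : binomPow 1 = 1 - 4 * PowerSeries.X ^ 2 := by
  have : PowerSeries.binomialSeries ℚ (1 : ℚ) = (1 + PowerSeries.X) ^ 1 := by
    exact_mod_cast PowerSeries.binomialSeries_nat (R := ℚ) (A := ℚ) 1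
  rw [binomPow, this, ← PowerSeries.coe_substAlgHom hasSubst_neg_four_mul, pow_one, map_add, map_one,
    PowerSeries.substAlgHom_X]
  ring

theorem constantCoeff_binomPow (e : ℚ) : PowerSeries.constantCoeff (binomPow e) = 1 := by
  change MvPowerSeries.constantCoeff (σ := Unit) (R := ℚ) _ = 1
  rw [binomPow, PowerSeries.constantCoeff_subst hasSubst_neg_four_mul,
    finsum_eq_single _ 0]
  · simp
  · intro n hn
    change _ • PowerSeries.constantCoeff _ = 0
    simp [hn]

theorem binomPow_half_sq : binomPow (1 / 2) ^ 2 = 1 - 4 * PowerSeries.X ^ 2 := by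
  rw [sq, ← binomPow_add, ← binomPow_one]; norm_num

theorem S_eq (e : ℚ) : S e = ((binomPow e : ℚ⟦X⟧) : ℚ⸨X⸩) := rfl

theorem S_add (e f : ℚ) : S (e + f) = S e * S f := by
  simp only [S_eq, binomPow_add]; exact map_mul (HahnSeries.ofPowerSeries ℤ ℚ) _ _

theorem S_zero : S 0 = 1 := by
  rw [S_eq, binomPow_zero]; exact map_one (HahnSeries.ofPowerSeries ℤ ℚ)

/-- By the quadratic equation for the odd series both sides have square `1 - 4 X ^ 2`; their
constant terms, both `1`, select the same root. -/
theorem binomPow_half_eq : binomPow (1 / 2) =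
    1 - 2 * PowerSeries.X * altSeries (oddInd ℚ) 0 := by
  have h := (altSeries_equations (χ := oddInd ℚ) oddInd_add_two rfl rfl rfl rfl rfl rfl rfl rfl rfl
    rfl rfl rfl rfl rfl).1
  have h0 : oddInd ℚ 0 = 0 := by simp [oddInd]
  have h1 : oddInd ℚ 1 = 1 := by simp [oddInd]
  rw [h0, h1, map_zero, map_one] at h
  have hsq := binomPow_half_sq
  set o := altSeries (oddInd ℚ) 0
  set s := binomPow (1 / 2) with hs
  have hz : (s - (1 - 2 * PowerSeries.X * o)) * (s + (1 - 2 * PowerSeries.X * o)) = 0 := by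
    linear_combination hsq + 4 * PowerSeries.X * h
  rcases mul_eq_zero.1 hz with hz | hz
  · exact sub_eq_zero.1 hz
  · have := congrArg PowerSeries.constantCoeff hz
    simp [hs, constantCoeff_binomPow] at this

/-- The solution of the system of functional equations in a field. -/
theorem solve_system {K : Type*} [Field K] [CharZero K] {y c s u₀ u₁ u₂ u₃ p₁ p₂ p₃ : K}
    (hy : y = c * (1 - c)) (hs : s = 1 - 2 * c) (hc0 : c ≠ 0) (hc1 : 1 - c ≠ 0) (hc2 : s ≠ 0)
    (hu₀ : u₀ = 1 + c * u₀)
    (hp₁ : p₁ = c * p₁ + p₁ * c + y * (u₀ * c))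
    (hu₁ : u₁ = c * u₁ + p₁ * u₀ + y * (u₀ * (u₀ - 1)))
    (hp₂ : p₂ = c * p₂ + p₁ * p₁ + p₂ * c + y * (u₀ * p₁ + u₁ * c + u₀ * (c - y)))
    (hu₂ : u₂ = c * u₂ + p₁ * u₁ + p₂ * u₀ + y * (u₀ * u₁ + u₁ * (u₀ - 1) + u₀ * (u₀ - 1)))
    (hp₃ : p₃ = c * p₃ + p₁ * p₂ + p₂ * p₁ + p₃ * c + y * (u₀ * p₂ + u₁ * p₁ + u₂ * c +
      u₀ * p₁ + u₁ * (c - y) - u₀ * (y * c) + u₀ * (c - y - y * c)) + y ^ 2 * ((u₀ ^ 2 + u₀) * c))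
    (hu₃ : u₃ = c * u₃ + p₁ * u₂ + p₂ * u₁ + p₃ * u₀ + y * (u₀ * u₂ + u₁ * u₁ + u₂ * (u₀ - 1) +
      u₀ * u₁ + u₁ * (u₀ - 1) - u₀ * (y * (u₀ - 1)) + u₀ * (u₀ - 1 - y - y * (u₀ - 1))) +
      y ^ 2 * ((u₀ ^ 2 + u₀) * (u₀ - 1))) :
    (u₀ = (1 - s) / (2 * y)) ∧
    (p₁ = -1 / 2 + (1 - 2 * y) / 2 * s⁻¹) ∧
    (u₁ = (y - 1) / y + (1 - 3 * y) / y * s⁻¹) ∧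
    (p₂ = 1 / 2 - (1 - 6 * y + 6 * y ^ 2) / 2 * s⁻¹ ^ 3) ∧
    (u₂ = (4 - 5 * y) / (2 * y) - (4 - 29 * y + 54 * y ^ 2 - 16 * y ^ 3) / (2 * y) * s⁻¹ ^ 3) ∧
    (p₃ = -2 * (1 - y) + (2 - 22 * y + 80 * y ^ 2 - 98 * y ^ 3 + 16 * y ^ 4) * s⁻¹ ^ 5) ∧
    (u₃ = -(13 - 22 * y + 2 * y ^ 2) / (2 * y) +
      (13 - 152 * y + 612 * y ^ 2 - 940 * y ^ 3 + 384 * y ^ 4) / (2 * y) * s⁻¹ ^ 5) := by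
  subst hy
  -- The unknowns are found in the order `u₀, p₁, u₁, p₂, u₂, p₃, u₃`. Collecting the new unknown
  -- leaves the factor `1 - 2 c = s` in an odd equation, where it occurs in two products with `c`,
  -- and `1 - c` in an even one.
  have hu₀' : u₀ = 1 / (1 - c) := by
    rw [eq_div_iff hc1]; linear_combination hu₀
  subst hu₀'
  have hp₁' : p₁ = -1 / 2 + (1 - 2 * (c * (1 - c))) / 2 * s⁻¹ := by
    refine mul_left_cancel₀ hc2 ?_
    trans c * (1 - c) * (1 / (1 - c) * c)
    · linear_combination hp₁ + p₁ * hs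
    · field_simp; subst hs; ring
  clear hp₁
  have hu₁' : u₁ = (c * (1 - c) - 1) / (c * (1 - c)) +
      (1 - 3 * (c * (1 - c))) / (c * (1 - c)) * s⁻¹ := by
    refine mul_left_cancel₀ hc1 ?_
    trans p₁ * (1 / (1 - c)) + c * (1 - c) * (1 / (1 - c) * (1 / (1 - c) - 1))
    · linear_combination hu₁
    · rw [hp₁']; field_simp; subst hs; ring
  clear hu₁
  have hp₂' : p₂ = 1 / 2 - (1 - 6 * (c * (1 - c)) + 6 * (c * (1 - c)) ^ 2) / 2 * s⁻¹ ^ 3 := by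
    refine mul_left_cancel₀ hc2 ?_
    trans p₁ * p₁ + c * (1 - c) * (1 / (1 - c) * p₁ + u₁ * c + 1 / (1 - c) * (c - c * (1 - c)))
    · linear_combination hp₂ + p₂ * hs
    · rw [hp₁', hu₁']; field_simp; subst hs; ring
  clear hp₂
  have hu₂' : u₂ = (4 - 5 * (c * (1 - c))) / (2 * (c * (1 - c))) -
      (4 - 29 * (c * (1 - c)) + 54 * (c * (1 - c)) ^ 2 - 16 * (c * (1 - c)) ^ 3) /
        (2 * (c * (1 - c))) * s⁻¹ ^ 3 := by
    refine mul_left_cancel₀ hc1 ?_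
    trans p₁ * u₁ + p₂ * (1 / (1 - c)) + c * (1 - c) * (1 / (1 - c) * u₁ +
      u₁ * (1 / (1 - c) - 1) + 1 / (1 - c) * (1 / (1 - c) - 1))
    · linear_combination hu₂
    · rw [hp₁', hu₁', hp₂']; field_simp; subst hs; ring
  clear hu₂
  have hp₃' : p₃ = -2 * (1 - c * (1 - c)) + (2 - 22 * (c * (1 - c)) + 80 * (c * (1 - c)) ^ 2 -
      98 * (c * (1 - c)) ^ 3 + 16 * (c * (1 - c)) ^ 4) * s⁻¹ ^ 5 := by
    refine mul_left_cancel₀ hc2 ?_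
    trans 2 * (p₁ * p₂) + c * (1 - c) * (1 / (1 - c) * p₂ + u₁ * p₁ + u₂ * c +
      1 / (1 - c) * p₁ + u₁ * (c - c * (1 - c)) - 1 / (1 - c) * (c * (1 - c) * c) +
      1 / (1 - c) * (c - c * (1 - c) - c * (1 - c) * c)) +
      (c * (1 - c)) ^ 2 * (((1 / (1 - c)) ^ 2 + 1 / (1 - c)) * c)
    · linear_combination hp₃ + p₃ * hs
    · rw [hp₁', hu₁', hp₂', hu₂']; field_simp; subst hs; ring
  clear hp₃
  refine ⟨?_, hp₁', hu₁', hp₂', hu₂', hp₃', ?_⟩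
  · field_simp; subst hs; ring
  · refine mul_left_cancel₀ hc1 ?_
    trans p₁ * u₂ + p₂ * u₁ + p₃ * (1 / (1 - c)) + c * (1 - c) * (1 / (1 - c) * u₂ + u₁ * u₁ +
      u₂ * (1 / (1 - c) - 1) + 1 / (1 - c) * u₁ + u₁ * (1 / (1 - c) - 1) -
      1 / (1 - c) * (c * (1 - c) * (1 / (1 - c) - 1)) +
      1 / (1 - c) * (1 / (1 - c) - 1 - c * (1 - c) - c * (1 - c) * (1 / (1 - c) - 1))) +
      (c * (1 - c)) ^ 2 * (((1 / (1 - c)) ^ 2 + 1 / (1 - c)) * (1 / (1 - c) - 1))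
    · linear_combination hu₃
    · rw [hp₁', hu₁', hp₂', hu₂', hp₃']; field_simp; subst hs; ring

end AltPerm

/-! ### Closed forms as Laurent series. -/

namespace AltPerm

instance charZero_laurentSeries : CharZero ℚ⸨X⸩ :=
  charZero_of_injective_ringHom (f := (HahnSeries.ofPowerSeries ℤ ℚ).comp PowerSeries.C)
    (HahnSeries.ofPowerSeries_injective.comp PowerSeries.C_injective)

theorem x_ne_zero : x ≠ 0 := fun h => PowerSeries.X_ne_zero (R := ℚ)
  (HahnSeries.ofPowerSeries_injective (Γ := ℤ) (h.trans (map_zero _).symm))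

theorem S_half_mul : S (1 / 2) * S (-1 / 2) = 1 := by
  rw [← S_add, ← S_zero]; norm_num

theorem S_half_ne_zero : S (1 / 2) ≠ 0 := left_ne_zero_of_mul_eq_one S_half_mul

theorem S_neg_half : S (-1 / 2) = (S (1 / 2))⁻¹ := eq_inv_of_mul_eq_one_right S_half_mul

theorem S_neg_one : S (-1) = (S (1 / 2))⁻¹ ^ 2 := by
  rw [← S_neg_half, sq, ← S_add]; norm_num

theorem S_neg_three_halves : S (-3 / 2) = (S (1 / 2))⁻¹ ^ 3 := by
  rw [pow_succ, ← S_neg_one, ← S_neg_half, ← S_add]; norm_num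

theorem S_neg_five_halves : S (-5 / 2) = (S (1 / 2))⁻¹ ^ 5 := by
  rw [pow_succ, show 4 = 2 * 2 from rfl, pow_mul, ← S_neg_one, ← S_neg_half, sq, ← S_add, ← S_add]
  norm_num

/-- The series `altSeries (evenInd ℚ) r` as a Laurent series. -/
noncomputable def evenSeries (r : ℕ) : ℚ⸨X⸩ := HahnSeries.ofPowerSeries ℤ ℚ (altSeries (evenInd ℚ) r)

/-- The series `altSeries (oddInd ℚ) r` as a Laurent series. -/
noncomputable def oddSeries (r : ℕ) : ℚ⸨X⸩ := HahnSeries.ofPowerSeries ℤ ℚ (altSeries (oddInd ℚ) r)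

theorem S_half_eq : S (1 / 2) = 1 - 2 * (x * oddSeries 0) := by
  have h := congrArg (HahnSeries.ofPowerSeries ℤ ℚ) binomPow_half_eq
  simp only [map_sub, map_one, map_mul, map_ofNat] at h
  rw [S_eq]
  refine h.trans ?_
  change 1 - 2 * x * oddSeries 0 = _
  ring

theorem series_formulas :
    x * oddSeries 0 = (1 - S (1 / 2)) / 2 ∧
    evenSeries 0 = (1 - S (1 / 2)) / (2 * x ^ 2) ∧
    x * oddSeries 1 = -1 / 2 + (1 - 2 * x ^ 2) / 2 * S (-1 / 2) ∧
    evenSeries 1 = (x ^ 2 - 1) / x ^ 2 + (1 - 3 * x ^ 2) / x ^ 2 * S (-1 / 2) ∧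
    x * oddSeries 2 = 1 / 2 - (1 - 6 * x ^ 2 + 6 * x ^ 4) / 2 * S (-3 / 2) ∧
    evenSeries 2 = (4 - 5 * x ^ 2) / (2 * x ^ 2) -
      (4 - 29 * x ^ 2 + 54 * x ^ 4 - 16 * x ^ 6) / (2 * x ^ 2) * S (-3 / 2) ∧
    x * oddSeries 3 = -2 * (1 - x ^ 2) +
      (2 - 22 * x ^ 2 + 80 * x ^ 4 - 98 * x ^ 6 + 16 * x ^ 8) * S (-5 / 2) ∧
    evenSeries 3 = -(13 - 22 * x ^ 2 + 2 * x ^ 4) / (2 * x ^ 2) +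
      (13 - 152 * x ^ 2 + 612 * x ^ 4 - 940 * x ^ 6 + 384 * x ^ 8) / (2 * x ^ 2) *
        S (-5 / 2) := by
  obtain ⟨o0, o1, o2, o3⟩ := altSeries_equations (χ := oddInd ℚ) oddInd_add_two
    rfl rfl rfl rfl rfl rfl rfl rfl rfl rfl rfl rfl rfl rfl
  obtain ⟨e0, e1, e2, e3⟩ := altSeries_equations (χ := evenInd ℚ) evenInd_add_two
    rfl rfl rfl rfl rfl rfl rfl rfl rfl rfl rfl rfl rfl rfl
  have h0 : oddInd ℚ 0 = 0 := by simp [oddInd]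
  have h1 : oddInd ℚ 1 = 1 := by simp [oddInd]
  have h2 : evenInd ℚ 0 = 1 := by simp [evenInd]
  have h3 : evenInd ℚ 1 = 0 := by simp [evenInd]
  have hx : HahnSeries.ofPowerSeries ℤ ℚ PowerSeries.X = x := rfl
  have ho : ∀ r, HahnSeries.ofPowerSeries ℤ ℚ (altSeries (oddInd ℚ) r) = oddSeries r := fun _ => rfl
  have he : ∀ r, HahnSeries.ofPowerSeries ℤ ℚ (altSeries (evenInd ℚ) r) = evenSeries r :=
    fun _ => rfl
  replace o0 := congrArg (HahnSeries.ofPowerSeries ℤ ℚ) o0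
  replace o1 := congrArg (HahnSeries.ofPowerSeries ℤ ℚ) o1
  replace o2 := congrArg (HahnSeries.ofPowerSeries ℤ ℚ) o2
  replace o3 := congrArg (HahnSeries.ofPowerSeries ℤ ℚ) o3
  replace e0 := congrArg (HahnSeries.ofPowerSeries ℤ ℚ) e0
  replace e1 := congrArg (HahnSeries.ofPowerSeries ℤ ℚ) e1
  replace e2 := congrArg (HahnSeries.ofPowerSeries ℤ ℚ) e2
  replace e3 := congrArg (HahnSeries.ofPowerSeries ℤ ℚ) e3
  simp only [map_sub, map_add, map_mul, map_pow, h0, h1, h2, h3, map_zero,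
    map_one, hx, ho, he]
    at o0 o1 o2 o3 e0 e1 e2 e3
  -- The quadratic equation of the odd series multiplied by `x`. Odd series enter the system as `p =
  -- x * oddSeries r`, which makes every equation one in `y = x ^ 2`.
  have hy : x ^ 2 = x * oddSeries 0 * (1 - x * oddSeries 0) := by linear_combination -x * o0
  have hne : x * oddSeries 0 * (1 - x * oddSeries 0) ≠ 0 := hy ▸ pow_ne_zero 2 x_ne_zero
  obtain ⟨f1, f2, f3, f4, f5, f6, f7⟩ := solve_system (u₀ := evenSeries 0) (u₁ := evenSeries 1)
    (u₂ := evenSeries 2) (u₃ := evenSeries 3) (p₁ := x * oddSeries 1) (p₂ := x * oddSeries 2)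
    (p₃ := x * oddSeries 3) hy S_half_eq (left_ne_zero_of_mul hne) (right_ne_zero_of_mul hne)
    S_half_ne_zero
    (by linear_combination e0) (by linear_combination x * o1) (by linear_combination e1)
    (by linear_combination x * o2) (by linear_combination e2) (by linear_combination x * o3)
    (by linear_combination e3)
  rw [S_neg_half, S_neg_three_halves, S_neg_five_halves]
  refine ⟨?_, f1, f2, f3, ?_, ?_, ?_, ?_⟩
  · rw [S_half_eq]; ring
  · rw [f4]; ring
  · rw [f5]; ring
  · rw [f6]; ring
  · rw [f7]; ring

theorem coe_UD (r : ℕ) : (UD r : ℚ⸨X⸩) = oddSeries r - if r = 0 then x else 0 := by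
  refine (congrArg (HahnSeries.ofPowerSeries ℤ ℚ) (UD_eq r)).trans ?_
  rw [map_sub, apply_ite (HahnSeries.ofPowerSeries ℤ ℚ), map_zero]; rfl

theorem coe_UU (r : ℕ) : (UU r : ℚ⸨X⸩) = evenSeries r - if r = 0 then 1 else 0 := by
  refine (congrArg (HahnSeries.ofPowerSeries ℤ ℚ) (UU_eq r)).trans ?_
  rw [map_sub, apply_ite (HahnSeries.ofPowerSeries ℤ ℚ), map_zero, map_one]; rfl

theorem coe_A (r : ℕ) : (A r : ℚ⸨X⸩) = evenSeries r + oddSeries r :=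
  (congrArg (HahnSeries.ofPowerSeries ℤ ℚ) (A_eq r)).trans (map_add _ _ _)

end AltPerm

open AltPerm in
theorem theorem6p5 :
    ((UD 0 : ℚ⸨X⸩) = (1 - 2 * x ^ 2) / (2 * x) - 1 / (2 * x) * S (1 / 2) ∧
     (UD 1 : ℚ⸨X⸩) = (-1) / (2 * x) + (1 - 2 * x ^ 2) / (2 * x) * S (-1 / 2) ∧
     (UD 2 : ℚ⸨X⸩) = 1 / (2 * x) - (1 - 6 * x ^ 2 + 6 * x ^ 4) / (2 * x) * S (-3 / 2) ∧
     (UD 3 : ℚ⸨X⸩) = (-2 * (1 - x ^ 2)) / x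
        + (2 - 22 * x ^ 2 + 80 * x ^ 4 - 98 * x ^ 6 + 16 * x ^ 8) / x * S (-5 / 2)) ∧
    ((UU 0 : ℚ⸨X⸩) = (1 - 2 * x ^ 2) / (2 * x ^ 2) - 1 / (2 * x ^ 2) * S (1 / 2) ∧
     (UU 1 : ℚ⸨X⸩) = (x ^ 2 - 1) / x ^ 2 + (1 - 3 * x ^ 2) / x ^ 2 * S (-1 / 2) ∧
     (UU 2 : ℚ⸨X⸩) = (4 - 5 * x ^ 2) / (2 * x ^ 2)
        - (4 - 29 * x ^ 2 + 54 * x ^ 4 - 16 * x ^ 6) / (2 * x ^ 2) * S (-3 / 2) ∧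
     (UU 3 : ℚ⸨X⸩) = -(13 - 22 * x ^ 2 + 2 * x ^ 4) / (2 * x ^ 2)
        + (13 - 152 * x ^ 2 + 612 * x ^ 4 - 940 * x ^ 6 + 384 * x ^ 8) / (2 * x ^ 2)
          * S (-5 / 2)) ∧
    ((A 0 : ℚ⸨X⸩) = 1 + x + (1 + x - 2 * x ^ 2 - 2 * x ^ 3) / (2 * x ^ 2)
        - (1 + x) / (2 * x ^ 2) * S (1 / 2) ∧
     (A 1 : ℚ⸨X⸩) = (2 * x ^ 2 - x - 2) / (2 * x ^ 2)
        + (2 + x - 6 * x ^ 2 - 2 * x ^ 3) / (2 * x ^ 2) * S (-1 / 2) ∧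
     (A 2 : ℚ⸨X⸩) = (4 + x - 5 * x ^ 2) / (2 * x ^ 2)
        - (4 + x - 29 * x ^ 2 - 6 * x ^ 3 + 54 * x ^ 4 + 6 * x ^ 5 - 16 * x ^ 6) / (2 * x ^ 2)
          * S (-3 / 2) ∧
     (A 3 : ℚ⸨X⸩) = -(13 + 4 * x - 22 * x ^ 2 - 4 * x ^ 3 + 2 * x ^ 4) / (2 * x ^ 2)
        + (13 + 4 * x - 152 * x ^ 2 - 44 * x ^ 3 + 612 * x ^ 4 + 160 * x ^ 5 - 940 * x ^ 6
            - 196 * x ^ 7 + 384 * x ^ 8 + 32 * x ^ 9) / (2 * x ^ 2) * S (-5 / 2)) := by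
  obtain ⟨o0, e0, o1, e1, o2, e2, o3, e3⟩ := series_formulas
  have hx := x_ne_zero
  have hdiv : ∀ {a b : ℚ⸨X⸩}, x * a = b → a = b / x := fun h =>
    eq_div_of_mul_eq hx ((mul_comm _ _).trans h)
  replace o0 := hdiv o0
  replace o1 := hdiv o1
  replace o2 := hdiv o2
  replace o3 := hdiv o3
  simp only [coe_UD, coe_UU, coe_A, if_pos, one_ne_zero, OfNat.ofNat_ne_zero, if_false, sub_zero,
    o0, o1, o2, o3, e0, e1, e2, e3]
  generalize S (1 / 2) = s
  generalize S (-1 / 2) = s₁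
  generalize S (-3 / 2) = s₃
  generalize S (-5 / 2) = s₅
  generalize x = z at hx ⊢
  refine ⟨⟨?_, ?_, ?_, ?_⟩, ⟨?_, ?_, ?_, ?_⟩, ?_, ?_, ?_, ?_⟩ <;>
    first | trivial | (field_simp <;> ring1)
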